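/- Let $m_1,m_2\ge 0$ be integers, $m=m_1+m_2$, $0<l<\infty$, and let $v$ be a measurable $m_1\times m_2$ matrix function with $\|v(x)\|\le M$ for $0<x<l$. Let $u(x,z)$ be the fundamental solution, normalized by $u(0,z)=I_m$ and absolutely continuous in $x$, of the skew-self-adjoint Dirac system $$\frac{d}{dx}u(x,z)=\big(\mathrm{i}zj+jV(x)\big)u(x,z),\qquad j=\begin{bmatrix}I_{m_1}&0\\0&-I_{m_2}\end{bmatrix},\quad V=\begin{bmatrix}0&v\\v^*&0\end{bmatrix}\qquad(0\le x\le l),$$ and put $\beta(x)=\begin{bmatrix}I_{m_1}&0\end{bmatrix}u(x,0)$, $\gamma(x)=\begin{bmatrix}0&I_{m_2}\end{bmatrix}u(x,0)=\begin{bmatrix}\gamma_1(x)&\gamma_2(x)\end{bmatrix}$, where $\gamma_k$ has $m_k$ columns. Call a bounded and boundedly invertible operator $E$ on $L^2_{m_2}(0,l)$ a normalized similarity operator for $\gamma$ if * $K=EAE^{-1}$, where $(Af)(x)=-\mathrm{i}\int_0^xf(t)\,dt$ and $(Kf)(x)=-\mathrm{i}\,\gamma(x)\int_0^x\gamma(t)^*f(t)\,dt$;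 * $E$ has the triangular form $(Ef)(x)=\rho(x)f(x)+\int_0^xE(x,t)f(t)\,dt$ with a bounded measurable kernel $E(x,t)$ and an absolutely continuous $\rho$ such that $\rho'=\gamma'\gamma^*\rho$ almost everywhere and $\det\rho(0)\ne0$; * $E^{-1}\gamma_2\equiv I_{m_2}$ ($E^{-1}$ is applied columnwise). Such an operator $E$ exists. For every such $E$ put $S=E^{-1}(E^*)^{-1}$ and let $S_x=P_xSP_x^*$, where $P_x$ is the restriction map from $L^2_{m_2}(0,l)$ onto $L^2_{m_2}(0,x)$. Then the matrix function $\Phi_1:=E^{-1}\gamma_1$ (columnwise) is boundedly differentiable on $[0,l]$, that is, it has an absolutely continuous representative with bounded derivative; for every $x\in[0,l]$ the operator $S_x$ is boundedly invertible; and $$\beta(x)=\begin{bmatrix}I_{m_1}&0\end{bmatrix}-\int_0^x\big(S_x^{-1}\Phi_1'\big)(t)^*\begin{bmatrix}\Phi_1(t)&I_{m_2}\end{bmatrix}dt,\qquad 0\le x\le l,$$ where $S_x^{-1}$ is applied columnwise and the integrand is integrable. -/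

import Mathlib

open MeasureTheory Set
open scoped Matrix Matrix.Norms.L2Operator

noncomputable section

namespace SkewDirac

/-! ### The Dirac system `y' = (i z j + j V) y` on `[0, l]` -/

/-- `j = diag (I, -I)`. -/
def jMat (m₁ m₂ : ℕ) : Matrix (Fin m₁ ⊕ Fin m₂) (Fin m₁ ⊕ Fin m₂) ℂ :=
  Matrix.fromBlocks 1 0 0 (-1)

/-- `V = [[0, v], [v*, 0]]`. -/
def vMat {m₁ m₂ : ℕ} (v : Matrix (Fin m₁) (Fin m₂) ℂ) :
    Matrix (Fin m₁ ⊕ Fin m₂) (Fin m₁ ⊕ Fin m₂) ℂ :=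
  Matrix.fromBlocks 0 v vᴴ 0

/-- `u(x, z)` is the fundamental solution on `[0, l]` of the Dirac system with potential `v`,
normalized by `u(0, z) = I`: it is absolutely continuous in `x` and satisfies the system
almost everywhere. -/
structure IsFundamentalSolution {m₁ m₂ : ℕ} (l : ℝ) (v : ℝ → Matrix (Fin m₁) (Fin m₂) ℂ)
    (u : ℝ → ℂ → Matrix (Fin m₁ ⊕ Fin m₂) (Fin m₁ ⊕ Fin m₂) ℂ) : Prop where
  absCont : ∀ z : ℂ, AbsolutelyContinuousOnInterval (fun x => u x z) 0 l
  initial : ∀ z : ℂ, u 0 z = 1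
  ode : ∀ z : ℂ, ∀ᵐ x ∂(volume.restrict (Ioo 0 l)),
    HasDerivAt (fun x => u x z)
      (((Complex.I * z) • jMat m₁ m₂ + jMat m₁ m₂ * vMat (v x)) * u x z) x

/-- `β(x) = [I 0] u(x, 0)`. -/
def beta {m₁ m₂ : ℕ} (u : ℝ → ℂ → Matrix (Fin m₁ ⊕ Fin m₂) (Fin m₁ ⊕ Fin m₂) ℂ) (x : ℝ) :
    Matrix (Fin m₁) (Fin m₁ ⊕ Fin m₂) ℂ :=
  Matrix.fromCols 1 0 * u x 0

/-- `γ(x) = [0 I] u(x, 0)`. -/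
def gamma {m₁ m₂ : ℕ} (u : ℝ → ℂ → Matrix (Fin m₁ ⊕ Fin m₂) (Fin m₁ ⊕ Fin m₂) ℂ) (x : ℝ) :
    Matrix (Fin m₂) (Fin m₁ ⊕ Fin m₂) ℂ :=
  Matrix.fromCols 0 1 * u x 0

/-- `f` is boundedly differentiable on `[0, l]`: absolutely continuous with bounded derivative.
(`deriv` is `0` at points where there is no derivative; by absolute continuity these form a
null set, so the bound is a bound on the derivative wherever it exists.) -/
def BoundedlyDifferentiableOn {p q : ℕ} (f : ℝ → Matrix (Fin p) (Fin q) ℂ) (l : ℝ) : Prop :=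
  AbsolutelyContinuousOnInterval f 0 l ∧ ∃ C : ℝ, ∀ x ∈ Ioo 0 l, ‖deriv f x‖ ≤ C

/-! ### Operators in `L²` -/

/-- The Hilbert space `L²_n(0, l)` of `ℂⁿ`-valued functions. -/
abbrev L2 (n : ℕ) (l : ℝ) : Type :=
  Lp (EuclideanSpace ℂ (Fin n)) 2 (volume.restrict (Ioo (0 : ℝ) l))

/-- The Hilbert space `L²_n(0, x)` for `0 ≤ x ≤ l` (in this range `(0, x) ⊆ (0, l)`, so the
iterated restriction of Lebesgue measure is the Lebesgue measure on `(0, x)`). -/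
abbrev L2Sub (n : ℕ) (l x : ℝ) : Type :=
  Lp (EuclideanSpace ℂ (Fin n)) 2 ((volume.restrict (Ioo (0 : ℝ) l)).restrict (Ioo (0 : ℝ) x))

/-- The `k`-th column of the matrix function `Ψ`, as an element of `L²(μ)` (for `Ψ` with
square integrable columns). -/
def column {p q : ℕ} (μ : Measure ℝ) (Ψ : ℝ → Matrix (Fin p) (Fin q) ℂ) (k : Fin q) :
    Lp (EuclideanSpace ℂ (Fin p)) 2 μ :=
  open Classical in
  if h : MemLp (fun t => (WithLp.toLp 2 (fun i => Ψ t i k) : EuclideanSpace ℂ (Fin p))) 2 μ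
  then h.toLp _ else 0

/-- An operator `T` on `L²(μ)` applied columnwise to a matrix function: `t ↦ (T Ψ)(t)`. -/
def applyColumns {p q : ℕ} {μ : Measure ℝ}
    (T : Lp (EuclideanSpace ℂ (Fin p)) 2 μ →L[ℂ] Lp (EuclideanSpace ℂ (Fin p)) 2 μ)
    (Ψ : ℝ → Matrix (Fin p) (Fin q) ℂ) (t : ℝ) : Matrix (Fin p) (Fin q) ℂ :=
  Matrix.of fun i k => (T (column μ Ψ k) : ℝ → EuclideanSpace ℂ (Fin p)) t i

/-- `A` is the operator `(A f)(x) = -i ∫₀ˣ f(t) dt` in `L²_n(0, l)`. -/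
def IsIntegration {n : ℕ} {l : ℝ} (A : L2 n l →L[ℂ] L2 n l) : Prop :=
  ∀ f : L2 n l, ∀ᵐ x ∂(volume.restrict (Ioo 0 l)),
    A f x = (-Complex.I) • ∫ t in (0 : ℝ)..x, f t

/-- `K` is the operator `(K f)(x) = ∫₀ˣ F(x) G(t) f(t) dt` in `L²_n(0, l)`. -/
def IsVolterra {n : ℕ} {ι : Type} [Fintype ι] {l : ℝ} (F : ℝ → Matrix (Fin n) ι ℂ)
    (G : ℝ → Matrix ι (Fin n) ℂ) (K : L2 n l →L[ℂ] L2 n l) : Prop :=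
  ∀ f : L2 n l, ∀ᵐ x ∂(volume.restrict (Ioo 0 l)),
    K f x = ∫ t in (0 : ℝ)..x, Matrix.toEuclideanCLM (𝕜 := ℂ) (F x * G t) (f t)

/-- `E` is a similarity operator for `K = ∫₀ˣ F(x) G(t) · dt`: a boundedly invertible operator
with `K = E A E⁻¹`, of the triangular form `(E f)(x) = ρ(x) f(x) + ∫₀ˣ E(x, t) f(t) dt` with a
bounded kernel, where `ρ' = i F' G ρ` and `det ρ(0) ≠ 0`. -/
structure IsSimilarity {n : ℕ} {ι : Type} [Fintype ι] [DecidableEq ι] {l : ℝ}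
    (F : ℝ → Matrix (Fin n) ι ℂ) (G : ℝ → Matrix ι (Fin n) ℂ)
    (E : L2 n l ≃L[ℂ] L2 n l) : Prop where
  similar : ∃ A K : L2 n l →L[ℂ] L2 n l, IsIntegration A ∧ IsVolterra F G K ∧
    K = (E : L2 n l →L[ℂ] L2 n l) ∘L A ∘L (E.symm : L2 n l →L[ℂ] L2 n l)
  triangular : ∃ (ρ : ℝ → Matrix (Fin n) (Fin n) ℂ) (k : ℝ → ℝ → Matrix (Fin n) (Fin n) ℂ),
    AbsolutelyContinuousOnInterval ρ 0 l ∧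
    (∀ᵐ x ∂(volume.restrict (Ioo 0 l)),
      HasDerivAt ρ (Complex.I • (deriv F x * G x * ρ x)) x) ∧
    (ρ 0).det ≠ 0 ∧
    StronglyMeasurable (fun p : ℝ × ℝ => k p.1 p.2) ∧
    (∃ C : ℝ, ∀ x t, ‖k x t‖ ≤ C) ∧
    ∀ f : L2 n l, ∀ᵐ x ∂(volume.restrict (Ioo 0 l)),
      E f x = Matrix.toEuclideanCLM (𝕜 := ℂ) (ρ x) (f x) +
        ∫ t in (0 : ℝ)..x, Matrix.toEuclideanCLM (𝕜 := ℂ) (k x t) (f t)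

/-- For `γ = [γ₁ γ₂]`: `E` is a similarity operator for `K = ∫₀ˣ F(x) G(t) · dt` with `F = γ`,
`G = -i γ*`, normalized by `E⁻¹ γ₂ ≡ I`. -/
structure IsNormalizedSimilarity {m₁ m₂ : ℕ} {l : ℝ}
    (γ : ℝ → Matrix (Fin m₂) (Fin m₁ ⊕ Fin m₂) ℂ) (E : L2 m₂ l ≃L[ℂ] L2 m₂ l) : Prop where
  isSimilarity : IsSimilarity γ (fun t => (-Complex.I) • (γ t)ᴴ) E
  normalized : ∀ᵐ x ∂(volume.restrict (Ioo 0 l)),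
    applyColumns (E.symm : L2 m₂ l →L[ℂ] L2 m₂ l) (fun t => (γ t).toCols₂) x = 1

/-- `Φ₁` is the boundedly differentiable matrix function `E⁻¹ γ₁` on `[0, l]`. -/
structure IsPhiOne {m₁ m₂ : ℕ} {l : ℝ} (γ : ℝ → Matrix (Fin m₂) (Fin m₁ ⊕ Fin m₂) ℂ)
    (E : L2 m₂ l ≃L[ℂ] L2 m₂ l) (Φ₁ : ℝ → Matrix (Fin m₂) (Fin m₁) ℂ) : Prop where
  eq_ae : ∀ᵐ x ∂(volume.restrict (Ioo 0 l)),
    Φ₁ x = applyColumns (E.symm : L2 m₂ l →L[ℂ] L2 m₂ l) (fun t => (γ t).toCols₁) x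
  boundedlyDifferentiable : BoundedlyDifferentiableOn Φ₁ l

/-- `S = E⁻¹ (E*)⁻¹`, written with `(E*)⁻¹ = (E⁻¹)*`. -/
def opS {n : ℕ} {l : ℝ} (E : L2 n l ≃L[ℂ] L2 n l) : L2 n l →L[ℂ] L2 n l :=
  (E.symm : L2 n l →L[ℂ] L2 n l) ∘L
    ContinuousLinearMap.adjoint (E.symm : L2 n l →L[ℂ] L2 n l)

/-- The projection `P_x` from `L²_n(0, l)` onto `L²_n(0, x)`: `(P_x f)(t) = f(t)`, `0 < t < x`. -/
def opP (n : ℕ) (l x : ℝ) : L2 n l →L[ℂ] L2Sub n l x :=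
  LpToLpRestrictCLM ℝ (EuclideanSpace ℂ (Fin n)) ℂ (volume.restrict (Ioo (0 : ℝ) l)) 2 (Ioo 0 x)

/-- `S_x = P_x S P_x*`. -/
def opSx {n : ℕ} {l : ℝ} (S : L2 n l →L[ℂ] L2 n l) (x : ℝ) : L2Sub n l x →L[ℂ] L2Sub n l x :=
  opP n l x ∘L S ∘L ContinuousLinearMap.adjoint (opP n l x)

end SkewDirac

end

open SkewDirac

/-!
At `z = 0` the two block rows of `u` satisfy `β' = v γ` and `γ' = -v* β`, and `u(x, 0)` is unitary,
so `γ γ* = 1` and `β γ* = 0`. In particular `γ' γ* = 0`, which forces `ρ` to be constant.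

For the existence of `E`, let `ε` and `π` solve the Goursat problem `∂ᵣ π = v(t + r) ε`,
`∂ₜ ε = -v(t + r)* π`, `π(0, t) = v(t)`, `ε(r, 0) = 0`, and let `E = I + N`, where `N` is the
Volterra operator with kernel `ε(x - t, t)`. Up to the factor `-i`, both `E A f` and `K E f` satisfy
the Volterra equation `y = r - ∫ v* ∫ v y` with the same `r`, whose solution is unique. The same
uniqueness gives `E I = γ₂`.

For the recovery of `β`, integrating by parts in `K v*` and using `K = E A E⁻¹` gives
`Φ₁' = -E⁻¹ v*`. Since `E` and `E⁻¹` are triangular, `S_x⁻¹` is the product of the compressions of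
`E*` and `E` to `(0, x)`, so that `S_x⁻¹ Φ₁' = -(P_x E P_x*)* P_x v*`. Moving `E` to the other
factor turns `[Φ₁ 1]` into `γ`, and the integral becomes `-∫ v γ = -∫ β'`.
-/

namespace SkewDirac

/-! ### Locally bounded measurable functions -/

theorem abs_le_of_mem_uIoc_zero {t x : ℝ} (ht : t ∈ uIoc 0 x) : |t| ≤ |x| := by
  simpa using abs_sub_left_of_mem_uIcc (uIoc_subset_uIcc ht)

theorem stronglyMeasurable_intervalIntegral {α E : Type*} [MeasurableSpace α]
    [NormedAddCommGroup E] [NormedSpace ℝ E] {f : α → ℝ → E}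
    (hf : StronglyMeasurable (Function.uncurry f)) {a b : α → ℝ} (ha : Measurable a)
    (hb : Measurable b) : StronglyMeasurable fun p => ∫ t in a p..b p, f p t := by
  have set_integral : ∀ {a b : α → ℝ}, Measurable a → Measurable b →
      StronglyMeasurable fun p => ∫ t in Ioc (a p) (b p), f p t := by
    intro a b ha hb
    have hS : MeasurableSet {q : α × ℝ | a q.1 < q.2 ∧ q.2 ≤ b q.1} :=
      (measurableSet_lt (ha.comp measurable_fst) measurable_snd).inter
        (measurableSet_le measurable_snd (hb.comp measurable_fst))
    convert! (hf.indicator hS).integral_prod_right' (ν := volume) using 2 with p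
    rw [← integral_indicator measurableSet_Ioc]
    rfl
  exact (set_integral ha hb).sub (set_integral hb ha)

/-- Strongly measurable functions that are bounded on bounded sets. All kernels and functions of
the Volterra calculus below are of this kind, so that integrability is automatic. -/
structure IsLocallyBounded {α X : Type*} [Norm α] [MeasurableSpace α] [NormedAddCommGroup X]
    (f : α → X) : Prop where
  stronglyMeasurable : StronglyMeasurable f
  exists_bound : ∀ R : ℝ, ∃ C, ∀ p, ‖p‖ ≤ R → ‖f p‖ ≤ C

namespace IsLocallyBounded

section Closure

variable {α β X Y Z : Type*} [NormedAddCommGroup α] [MeasurableSpace α]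
  [NormedAddCommGroup β] [MeasurableSpace β]
  [NormedAddCommGroup X] [NormedAddCommGroup Y] [NormedAddCommGroup Z]

theorem of_bound {f : α → X} (hf : StronglyMeasurable f) {C : ℝ} (hC : ∀ p, ‖f p‖ ≤ C) :
    IsLocallyBounded f :=
  ⟨hf, fun _ => ⟨C, fun p _ => hC p⟩⟩

theorem of_continuous [ProperSpace α] [BorelSpace α] {f : α → X} (hf : Continuous f) :
    IsLocallyBounded f where
  stronglyMeasurable := hf.stronglyMeasurable
  exists_bound R := by
    obtain ⟨C, hC⟩ := (isCompact_closedBall (0 : α) R).exists_bound_of_continuousOn hf.continuousOn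
    exact ⟨C, fun p hp => hC p (mem_closedBall_zero_iff.2 hp)⟩

theorem comp_continuous [ProperSpace β] [BorelSpace β] [BorelSpace α] {f : α → X}
    (hf : IsLocallyBounded f) {g : β → α} (hg : Continuous g) :
    IsLocallyBounded fun p => f (g p) where
  stronglyMeasurable := hf.stronglyMeasurable.comp_measurable hg.measurable
  exists_bound R := by
    obtain ⟨B, hB⟩ := (isCompact_closedBall (0 : β) R).exists_bound_of_continuousOn hg.continuousOn
    obtain ⟨C, hC⟩ := hf.exists_bound B
    exact ⟨C, fun p hp => hC _ (hB p (mem_closedBall_zero_iff.2 hp))⟩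

theorem neg {f : α → X} (hf : IsLocallyBounded f) : IsLocallyBounded fun p => -f p where
  stronglyMeasurable := hf.stronglyMeasurable.neg
  exists_bound R := by simpa only [norm_neg] using hf.exists_bound R

theorem add {f g : α → X} (hf : IsLocallyBounded f) (hg : IsLocallyBounded g) :
    IsLocallyBounded fun p => f p + g p where
  stronglyMeasurable := hf.stronglyMeasurable.add hg.stronglyMeasurable
  exists_bound R := by
    obtain ⟨C, hC⟩ := hf.exists_bound R
    obtain ⟨D, hD⟩ := hg.exists_bound R
    exact ⟨C + D, fun p hp => norm_add_le_of_le (hC p hp) (hD p hp)⟩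

theorem sub {f g : α → X} (hf : IsLocallyBounded f) (hg : IsLocallyBounded g) :
    IsLocallyBounded fun p => f p - g p := by
  simpa only [sub_eq_add_neg] using hf.add hg.neg

theorem indicator {f : α → X} (hf : IsLocallyBounded f) {s : Set α} (hs : MeasurableSet s) :
    IsLocallyBounded (s.indicator f) where
  stronglyMeasurable := hf.stronglyMeasurable.indicator hs
  exists_bound R := by
    obtain ⟨C, hC⟩ := hf.exists_bound R
    exact ⟨C, fun p hp => (norm_indicator_le_norm_self f p).trans (hC p hp)⟩

variable [NormedSpace ℂ X] [NormedSpace ℂ Y] [NormedSpace ℂ Z]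

theorem clm_apply {a : α → X →L[ℂ] Y} {f : α → X} (ha : IsLocallyBounded a)
    (hf : IsLocallyBounded f) : IsLocallyBounded fun p => a p (f p) where
  stronglyMeasurable := isBoundedBilinearMap_apply.continuous.comp_stronglyMeasurable
    (ha.stronglyMeasurable.prodMk hf.stronglyMeasurable)
  exists_bound R := by
    obtain ⟨C, hC⟩ := ha.exists_bound R
    obtain ⟨D, hD⟩ := hf.exists_bound R
    exact ⟨C * D, fun p hp => (a p).le_of_opNorm_le_of_le (hC p hp) (hD p hp)⟩

theorem clm_comp {a : α → Y →L[ℂ] Z} {b : α → X →L[ℂ] Y} (ha : IsLocallyBounded a)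
    (hb : IsLocallyBounded b) : IsLocallyBounded fun p => (a p).comp (b p) where
  stronglyMeasurable := isBoundedBilinearMap_comp.continuous.comp_stronglyMeasurable
    (ha.stronglyMeasurable.prodMk hb.stronglyMeasurable)
  exists_bound R := by
    obtain ⟨C, hC⟩ := ha.exists_bound R
    obtain ⟨D, hD⟩ := hb.exists_bound R
    refine ⟨C * D, fun p hp => ((a p).opNorm_comp_le (b p)).trans ?_⟩
    exact mul_le_mul (hC p hp) (hD p hp) (norm_nonneg _) ((norm_nonneg _).trans (hC p hp))

end Closure

section Integral

variable {X : Type*} [NormedAddCommGroup X]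

theorem locallyIntegrable {f : ℝ → X} (hf : IsLocallyBounded f) : LocallyIntegrable f := by
  refine locallyIntegrable_iff.2 fun K hK => ?_
  obtain ⟨R, hR⟩ := hK.isBounded.exists_norm_le
  obtain ⟨C, hC⟩ := hf.exists_bound R
  exact IntegrableOn.of_bound hK.measure_lt_top hf.stronglyMeasurable.aestronglyMeasurable C
    ((ae_restrict_mem hK.measurableSet).mono fun t ht => hC t (hR t ht))

theorem intervalIntegrable {f : ℝ → X} (hf : IsLocallyBounded f) (a b : ℝ) :
    IntervalIntegrable f volume a b :=
  (hf.locallyIntegrable.integrableOn_isCompact isCompact_uIcc).intervalIntegrable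

variable [NormedSpace ℝ X]

theorem parametric_intervalIntegral {α : Type*} [NormedAddCommGroup α] [ProperSpace α]
    [MeasurableSpace α] [BorelSpace α] {f : α × ℝ → X} (hf : IsLocallyBounded f) {b : α → ℝ}
    (hb : Continuous b) : IsLocallyBounded fun p => ∫ t in (0 : ℝ)..b p, f (p, t) where
  stronglyMeasurable := stronglyMeasurable_intervalIntegral (f := fun p t => f (p, t))
    hf.stronglyMeasurable measurable_const hb.measurable
  exists_bound R := by
    obtain ⟨B, hB⟩ := (of_continuous hb).exists_bound R
    obtain ⟨C, hC⟩ := hf.exists_bound (max R B)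
    refine ⟨|C| * B, fun p hp => ?_⟩
    have hfC : ∀ t ∈ uIoc 0 (b p), ‖f (p, t)‖ ≤ |C| := fun t ht =>
      (hC (p, t) (max_le_max hp ((abs_le_of_mem_uIoc_zero ht).trans (hB p hp)))).trans
        (le_abs_self C)
    refine (intervalIntegral.norm_integral_le_of_norm_le_const hfC).trans ?_
    rw [sub_zero]
    exact mul_le_mul_of_nonneg_left (hB p hp) (abs_nonneg C)

theorem continuous_primitive {f : ℝ → X} (hf : IsLocallyBounded f) :
    Continuous fun x => ∫ t in (0 : ℝ)..x, f t :=
  intervalIntegral.continuous_primitive hf.intervalIntegrable 0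

theorem primitive {f : ℝ → X} (hf : IsLocallyBounded f) :
    IsLocallyBounded fun x => ∫ t in (0 : ℝ)..x, f t :=
  of_continuous hf.continuous_primitive

end Integral

end IsLocallyBounded

/-! ### Primitives of locally bounded functions -/

theorem absolutelyContinuousOnInterval_bilinear {𝕜 X Y Z : Type*} [NontriviallyNormedField 𝕜]
    [NormedAddCommGroup X] [NormedSpace 𝕜 X] [NormedAddCommGroup Y] [NormedSpace 𝕜 Y]
    [NormedAddCommGroup Z] [NormedSpace 𝕜 Z] (B : X →L[𝕜] Y →L[𝕜] Z) {f : ℝ → X} {g : ℝ → Y}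
    {a b : ℝ} (hf : AbsolutelyContinuousOnInterval f a b)
    (hg : AbsolutelyContinuousOnInterval g a b) :
    AbsolutelyContinuousOnInterval (fun x => B (f x) (g x)) a b := by
  obtain ⟨C, hC⟩ := hf.exists_bound
  obtain ⟨D, hD⟩ := hg.exists_bound
  unfold AbsolutelyContinuousOnInterval at hf hg ⊢
  refine squeeze_zero' (Filter.Eventually.of_forall fun _ => Finset.sum_nonneg fun _ _ =>
    dist_nonneg) ?_ (by simpa using (hg.const_mul (‖B‖ * C)).add (hf.const_mul (‖B‖ * D)))
  rw [Filter.eventually_inf_principal]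
  filter_upwards with ⟨n, I⟩ hnI
  simp only [Finset.mul_sum, ← Finset.sum_add_distrib, dist_eq_norm]
  refine Finset.sum_le_sum fun i hi => ?_
  have split : B (f (I i).1) (g (I i).1) - B (f (I i).2) (g (I i).2) =
      B (f (I i).1) (g (I i).1 - g (I i).2) + B (f (I i).1 - f (I i).2) (g (I i).2) := by
    simp only [map_sub, FunLike.coe_sub, Pi.sub_apply]
    abel
  rw [split]
  refine norm_add_le_of_le ((B.le_opNorm₂ _ _).trans ?_) ((B.le_opNorm₂ _ _).trans ?_)
  · exact mul_le_mul_of_nonneg_right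
      (mul_le_mul_of_nonneg_left (hC _ (hnI.1 i hi).1) B.opNorm_nonneg) (norm_nonneg _)
  · rw [mul_right_comm]
    exact mul_le_mul_of_nonneg_right
      (mul_le_mul_of_nonneg_left (hD _ (hnI.1 i hi).2) B.opNorm_nonneg) (norm_nonneg _)

theorem absolutelyContinuousOnInterval_lipschitz_comp {X Y : Type*} [PseudoMetricSpace X]
    [PseudoMetricSpace Y] {φ : X → Y} {K : NNReal} (hφ : LipschitzWith K φ) {f : ℝ → X} {a b : ℝ}
    (hf : AbsolutelyContinuousOnInterval f a b) :
    AbsolutelyContinuousOnInterval (fun x => φ (f x)) a b := by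
  rw [absolutelyContinuousOnInterval_iff] at hf ⊢
  intro ε hε
  obtain ⟨δ, hδ, h⟩ := hf (ε / (K + 1)) (by positivity)
  refine ⟨δ, hδ, fun E hE hEδ => ?_⟩
  have hlt := h E hE hEδ
  rw [lt_div_iff₀ (by positivity), Finset.sum_mul] at hlt
  refine (Finset.sum_le_sum fun i _ => (hφ.dist_le_mul _ _).trans ?_).trans_lt hlt
  rw [mul_comm]
  gcongr
  exact le_add_of_nonneg_right zero_le_one

theorem absolutelyContinuousOnInterval_mul {R : Type*} [NormedRing R] [NormedAlgebra ℝ R]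
    {f g : ℝ → R} {a b : ℝ} (hf : AbsolutelyContinuousOnInterval f a b)
    (hg : AbsolutelyContinuousOnInterval g a b) :
    AbsolutelyContinuousOnInterval (fun x => f x * g x) a b :=
  absolutelyContinuousOnInterval_bilinear (ContinuousLinearMap.mul ℝ R) hf hg

/-- `F` is a primitive of the locally bounded function `f` on the whole line. -/
structure IsPrimitive {X : Type*} [NormedAddCommGroup X] [NormedSpace ℝ X] (F f : ℝ → X) :
    Prop where
  isLocallyBounded : IsLocallyBounded f
  eq_add_integral : ∀ x, F x = F 0 + ∫ t in (0 : ℝ)..x, f t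

theorem IsLocallyBounded.isPrimitive {X : Type*} [NormedAddCommGroup X] [NormedSpace ℝ X]
    {f : ℝ → X} (hf : IsLocallyBounded f) : IsPrimitive (fun x => ∫ t in (0 : ℝ)..x, f t) f :=
  ⟨hf, fun x => by simp only [intervalIntegral.integral_same, zero_add]⟩

namespace IsPrimitive

section Real

variable {X Y Z : Type*} [NormedAddCommGroup X] [NormedSpace ℝ X]
  [NormedAddCommGroup Y] [NormedSpace ℝ Y] [NormedAddCommGroup Z] [NormedSpace ℝ Z]
  {F f : ℝ → X}

theorem sub_eq_integral (h : IsPrimitive F f) (x y : ℝ) : F y - F x = ∫ t in x..y, f t := by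
  rw [h.eq_add_integral x, h.eq_add_integral y, add_sub_add_left_eq_sub,
    intervalIntegral.integral_interval_sub_left (h.isLocallyBounded.intervalIntegrable _ _)
      (h.isLocallyBounded.intervalIntegrable _ _)]

theorem exists_lipschitzOnWith (h : IsPrimitive F f) (R : ℝ) :
    ∃ C, LipschitzOnWith C F (Metric.closedBall 0 R) := by
  obtain ⟨C, hC⟩ := h.isLocallyBounded.exists_bound R
  refine ⟨C.toNNReal, LipschitzOnWith.of_dist_le_mul fun y hy x hx => ?_⟩
  rw [dist_eq_norm, h.sub_eq_integral, Real.dist_eq]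
  refine intervalIntegral.norm_integral_le_of_norm_le_const fun t ht => ?_
  have ht' : t ∈ Metric.closedBall (0 : ℝ) R :=
    (convex_closedBall (0 : ℝ) R).ordConnected.uIcc_subset hx hy (uIoc_subset_uIcc ht)
  exact (hC t (mem_closedBall_zero_iff.1 ht')).trans (Real.le_coe_toNNReal C)

theorem continuous (h : IsPrimitive F f) : Continuous F := by
  have hF : F = fun x => F 0 + ∫ t in (0 : ℝ)..x, f t := funext h.eq_add_integral
  rw [hF]
  exact continuous_const.add h.isLocallyBounded.continuous_primitive

theorem isLocallyBounded_left (h : IsPrimitive F f) : IsLocallyBounded F :=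
  .of_continuous h.continuous

theorem absolutelyContinuousOnInterval (h : IsPrimitive F f) (a b : ℝ) :
    AbsolutelyContinuousOnInterval F a b := by
  obtain ⟨R, hR⟩ := (isCompact_uIcc (a := a) (b := b)).isBounded.subset_closedBall 0
  obtain ⟨C, hC⟩ := h.exists_lipschitzOnWith R
  exact (hC.mono hR).absolutelyContinuousOnInterval

variable [CompleteSpace X]

theorem ae_hasDerivAt (h : IsPrimitive F f) : ∀ᵐ x, HasDerivAt F (f x) x := by
  filter_upwards [LocallyIntegrable.ae_hasDerivAt_integral h.isLocallyBounded.locallyIntegrable]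
    with x hx
  have hF : F = fun x => F 0 + ∫ t in (0 : ℝ)..x, f t := funext h.eq_add_integral
  rw [hF]
  exact (hx 0).const_add (F 0)

end Real

end IsPrimitive

theorem eq_add_integral_of_ae_hasDerivAt {X : Type*} [NormedAddCommGroup X] [NormedSpace ℝ X]
    [CompleteSpace X] {F f : ℝ → X} {a b : ℝ} (hF : AbsolutelyContinuousOnInterval F a b)
    (hf : IsLocallyBounded f) (hd : ∀ᵐ x, x ∈ uIcc a b → HasDerivAt F (f x) x) :
    ∀ x ∈ uIcc a b, F x = F a + ∫ t in a..x, f t := by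
  have hI := hf.isPrimitive
  have hsub : ∀ᵐ x, x ∈ uIcc a b →
      HasDerivAt (F - fun x => ∫ t in (0 : ℝ)..x, f t) 0 x := by
    filter_upwards [hd, hI.ae_hasDerivAt] with x hx hx' hxab
    simpa only [sub_self] using (hx hxab).sub hx'
  obtain ⟨c, hc⟩ :=
    (hF.sub (hI.absolutelyContinuousOnInterval a b)).const_of_ae_hasDerivAt_zero hsub
  intro x hx
  have heq := (hc x hx).trans (hc a left_mem_uIcc).symm
  rw [Pi.sub_apply, Pi.sub_apply, sub_eq_sub_iff_add_eq_add] at heq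
  rw [← hI.sub_eq_integral a x, add_sub, ← heq, add_sub_cancel_right]

namespace IsPrimitive

theorem of_ae_hasDerivAt {X : Type*} [NormedAddCommGroup X] [NormedSpace ℝ X]
    [CompleteSpace X] {F f : ℝ → X} (hF : ∀ x, AbsolutelyContinuousOnInterval F 0 x)
    (hf : IsLocallyBounded f) (hd : ∀ᵐ x, HasDerivAt F (f x) x) : IsPrimitive F f :=
  ⟨hf, fun x => eq_add_integral_of_ae_hasDerivAt (hF x) hf (hd.mono fun _ hy _ => hy) x
    right_mem_uIcc⟩

variable {X Y : Type*} [NormedAddCommGroup X] [NormedSpace ℂ X]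
  [NormedAddCommGroup Y] [NormedSpace ℂ Y]

theorem clm_apply [CompleteSpace X] [CompleteSpace Y] {A a : ℝ → X →L[ℂ] Y} {F f : ℝ → X}
    (hA : IsPrimitive A a) (hF : IsPrimitive F f) :
    IsPrimitive (fun x => A x (F x)) (fun x => a x (F x) + A x (f x)) := by
  let B : (X →L[ℂ] Y) →L[ℝ] X →L[ℝ] Y :=
    (ContinuousLinearMap.id ℂ (X →L[ℂ] Y)).bilinearRestrictScalars ℝ
  refine of_ae_hasDerivAt (fun x => absolutelyContinuousOnInterval_bilinear B
      (hA.absolutelyContinuousOnInterval 0 x) (hF.absolutelyContinuousOnInterval 0 x))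
    ((hA.isLocallyBounded.clm_apply hF.isLocallyBounded_left).add
      (hA.isLocallyBounded_left.clm_apply hF.isLocallyBounded)) ?_
  filter_upwards [hA.ae_hasDerivAt, hF.ae_hasDerivAt] with x hAx hFx
  rw [add_comm]
  exact B.hasDerivAt_of_bilinear (fun _ => hAx) (fun _ => hFx)

end IsPrimitive

theorem IsPrimitive.of_ae_hasDerivAt_projIcc {X : Type*} [NormedAddCommGroup X] [NormedSpace ℝ X]
    [CompleteSpace X] {F f : ℝ → X} {l : ℝ} (hl : 0 ≤ l)
    (hF : AbsolutelyContinuousOnInterval F 0 l) (hf : IsLocallyBounded f)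
    (hf0 : ∀ x ∉ Ioo 0 l, f x = 0)
    (hd : ∀ᵐ x ∂volume.restrict (Ioo 0 l), HasDerivAt F (f x) x) :
    IsPrimitive (fun x => F (projIcc 0 l hl x)) f := by
  have hd' : ∀ᵐ x, x ∈ uIcc 0 l → HasDerivAt F (f x) x := by
    rwa [← ae_restrict_iff' measurableSet_uIcc, uIcc_of_le hl, ← restrict_Ioo_eq_restrict_Icc]
  refine ⟨hf, fun x => ?_⟩
  have hzero : ∫ t in (projIcc 0 l hl x : ℝ)..x, f t = 0 := by
    refine intervalIntegral.integral_zero_ae (Filter.Eventually.of_forall fun t ht => hf0 t ?_)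
    rintro ⟨h0t, htl⟩
    rw [uIoc, mem_Ioc, coe_projIcc] at ht
    grind
  have hx := eq_add_integral_of_ae_hasDerivAt hF hf hd' _
    (by rw [uIcc_of_le hl]; exact (projIcc 0 l hl x).2)
  rw [projIcc_left, hx, ← intervalIntegral.integral_add_adjacent_intervals
    (hf.intervalIntegrable 0 (projIcc 0 l hl x)) (hf.intervalIntegrable _ x), hzero, add_zero]

/-! ### Double integrals over triangles -/

namespace IsLocallyBounded

variable {X : Type*} [NormedAddCommGroup X] [NormedSpace ℝ X] {f : ℝ × ℝ → X}

theorem integral_triangle_comm_of_nonneg (hf : IsLocallyBounded f) {x : ℝ} (hx : 0 ≤ x) :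
    ∫ t in (0 : ℝ)..x, ∫ r in (0 : ℝ)..(x - t), f (r, t) =
      ∫ r in (0 : ℝ)..x, ∫ t in (0 : ℝ)..(x - r), f (r, t) := by
  let T : Set (ℝ × ℝ) := {p | p.1 + p.2 ≤ x}
  have hT : MeasurableSet T := measurableSet_le (by fun_prop) measurable_const
  obtain ⟨C, hC⟩ := (hf.indicator hT).exists_bound x
  have hint : IntegrableOn (T.indicator f) (Ioc 0 x ×ˢ Ioc 0 x) (volume.prod volume) := by
    refine IntegrableOn.of_bound ?_ (hf.indicator hT).stronglyMeasurable.aestronglyMeasurable C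
      ((ae_restrict_mem (measurableSet_Ioc.prod measurableSet_Ioc)).mono fun p hp => hC p ?_)
    · simp [Measure.prod_prod, ENNReal.mul_lt_top]
    · rw [Prod.norm_def, max_le_iff, Real.norm_of_nonneg hp.1.1.le, Real.norm_of_nonneg hp.2.1.le]
      exact ⟨hp.1.2, hp.2.2⟩
  rw [IntegrableOn, ← Measure.prod_restrict] at hint
  have slice : ∀ g : ℝ → X, ∀ s ∈ Ioc 0 x,
      ∫ r in (0 : ℝ)..(x - s), g r = ∫ r in Ioc 0 x, (Iic (x - s)).indicator g r := by
    intro g s hs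
    rw [intervalIntegral.integral_of_le (sub_nonneg.2 hs.2), integral_indicator measurableSet_Iic,
      Measure.restrict_restrict measurableSet_Iic, inter_comm, Ioc_inter_Iic,
      min_eq_right (sub_le_self x hs.1.le)]
  rw [intervalIntegral.integral_of_le hx, intervalIntegral.integral_of_le hx]
  calc ∫ t in Ioc 0 x, ∫ r in (0 : ℝ)..(x - t), f (r, t)
      = ∫ t in Ioc 0 x, ∫ r in Ioc 0 x, T.indicator f (r, t) :=
        setIntegral_congr_fun measurableSet_Ioc fun t ht => by
          simp only [slice _ t ht, indicator_apply, mem_Iic, T, mem_ofPred_eq, le_sub_iff_add_le]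
    _ = ∫ r in Ioc 0 x, ∫ t in Ioc 0 x, T.indicator f (r, t) :=
        (integral_integral_swap (f := fun r t => T.indicator f (r, t)) hint).symm
    _ = ∫ r in Ioc 0 x, ∫ t in (0 : ℝ)..(x - r), f (r, t) :=
        setIntegral_congr_fun measurableSet_Ioc fun r hr => by
          simp only [slice _ r hr, indicator_apply, mem_Iic, T, mem_ofPred_eq, le_sub_iff_add_le']

theorem integral_triangle_comm (hf : IsLocallyBounded f) (x : ℝ) :
    ∫ t in (0 : ℝ)..x, ∫ r in (0 : ℝ)..(x - t), f (r, t) =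
      ∫ r in (0 : ℝ)..x, ∫ t in (0 : ℝ)..(x - r), f (r, t) := by
  rcases le_total 0 x with hx | hx
  · exact hf.integral_triangle_comm_of_nonneg hx
  have reflect : ∀ g : ℝ → ℝ → X, ∫ t in (0 : ℝ)..x, ∫ r in (0 : ℝ)..(x - t), g r t =
      ∫ t in (0 : ℝ)..-x, ∫ r in (0 : ℝ)..(-x - t), g (-r) (-t) := by
    intro g
    have inner : ∀ t, ∫ r in (0 : ℝ)..(-x - t), g (-r) (-t) =
        -∫ r in (0 : ℝ)..(x - -t), g r (-t) := fun t => by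
      rw [intervalIntegral.integral_comp_neg fun r => g r (-t), neg_zero,
        intervalIntegral.integral_symm, neg_sub, sub_neg_eq_add, sub_neg_eq_add, add_comm t x]
    simp only [inner]
    rw [intervalIntegral.integral_neg,
      intervalIntegral.integral_comp_neg fun t => ∫ r in (0 : ℝ)..(x - t), g r t, neg_neg,
      neg_zero, ← intervalIntegral.integral_symm]
  rw [reflect, reflect fun t r => f (r, t)]
  exact (hf.comp_continuous continuous_neg).integral_triangle_comm_of_nonneg (neg_nonneg.2 hx)

theorem integral_shear (hf : IsLocallyBounded f) (x : ℝ) :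
    ∫ s in (0 : ℝ)..x, ∫ t in (0 : ℝ)..s, f (s - t, t) =
      ∫ t in (0 : ℝ)..x, ∫ r in (0 : ℝ)..(x - t), f (r, t) := by
  have hg : IsLocallyBounded fun p : ℝ × ℝ => f (x - p.1 - p.2, p.2) :=
    hf.comp_continuous (by fun_prop)
  calc ∫ s in (0 : ℝ)..x, ∫ t in (0 : ℝ)..s, f (s - t, t)
      = ∫ r in (0 : ℝ)..x, ∫ t in (0 : ℝ)..(x - r), f (x - r - t, t) := by
        rw [intervalIntegral.integral_comp_sub_left
          (fun s => ∫ t in (0 : ℝ)..s, f (s - t, t)) x, sub_self, sub_zero]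
    _ = ∫ t in (0 : ℝ)..x, ∫ r in (0 : ℝ)..(x - t), f (x - r - t, t) :=
        (hg.integral_triangle_comm x).symm
    _ = ∫ t in (0 : ℝ)..x, ∫ r in (0 : ℝ)..(x - t), f (r, t) := by
        refine intervalIntegral.integral_congr fun t _ => ?_
        simp only [sub_right_comm x _ t,
          intervalIntegral.integral_comp_sub_left (fun r => f (r, t)), sub_self, sub_zero]

end IsLocallyBounded

/-! ### The Goursat problem -/

theorem norm_intervalIntegral_le_pow_div_factorial {X : Type*} [NormedAddCommGroup X]
    [NormedSpace ℝ X] {f : ℝ → X} {C t : ℝ} {n : ℕ}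
    (hf : ∀ s ∈ uIoc 0 t, ‖f s‖ ≤ C * (|s| ^ n / n.factorial)) :
    ‖∫ s in (0 : ℝ)..t, f s‖ ≤ C * (|t| ^ (n + 1) / (n + 1).factorial) := by
  have hbound : ‖∫ s in (0 : ℝ)..t, f s‖ ≤
      ∫ s in uIoc 0 t, C / n.factorial * |s - 0| ^ n := by
    rw [intervalIntegral.norm_integral_eq_norm_integral_uIoc]
    refine norm_integral_le_of_norm_le (Continuous.integrableOn_uIoc (by fun_prop)) ?_
    filter_upwards [ae_restrict_mem measurableSet_uIoc] with s hs
    rw [sub_zero, div_mul_eq_mul_div, ← mul_div_assoc']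
    exact hf s hs
  refine hbound.trans_eq ?_
  rw [integral_const_mul, integral_pow_abs_sub_uIoc, sub_zero, Nat.factorial_succ, Nat.cast_mul,
    Nat.cast_succ]
  field_simp

theorem hasSum_intervalIntegral_clm_comp {X Y Z : Type*} [NormedAddCommGroup X] [NormedSpace ℂ X]
    [NormedAddCommGroup Y] [NormedSpace ℂ Y] [NormedAddCommGroup Z] [NormedSpace ℂ Z]
    {a : ℝ → Y →L[ℂ] Z} {F : ℕ → ℝ → X →L[ℂ] Y} {f : ℝ → X →L[ℂ] Y} {B : ℕ → ℝ} {t : ℝ}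
    (ha : IsLocallyBounded a) (hF : ∀ n, IsLocallyBounded (F n)) (hB : Summable B)
    (hFB : ∀ n, ∀ s ∈ uIoc 0 t, ‖F n s‖ ≤ B n)
    (hsum : ∀ s ∈ uIoc 0 t, HasSum (fun n => F n s) (f s)) :
    HasSum (fun n => ∫ s in (0 : ℝ)..t, (a s).comp (F n s))
      (∫ s in (0 : ℝ)..t, (a s).comp (f s)) := by
  obtain ⟨C, hC⟩ := ha.exists_bound |t|
  refine intervalIntegral.hasSum_integral_of_dominated_convergence (fun n _ => C * B n)
    (fun n => (ha.clm_comp (hF n)).stronglyMeasurable.aestronglyMeasurable)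
    (fun n => .of_forall fun s hs => ?_) (.of_forall fun _ _ => hB.mul_left C)
    intervalIntegrable_const (.of_forall fun s hs => ?_)
  · have has := hC s (abs_le_of_mem_uIoc_zero hs)
    exact (ContinuousLinearMap.opNorm_comp_le _ _).trans
      (mul_le_mul has (hFB n s hs) (norm_nonneg _) ((norm_nonneg _).trans has))
  · exact (ContinuousLinearMap.compL ℂ X Y Z (a s)).hasSum (hsum s hs)

section Goursat

variable {H₁ H₂ : Type*} [NormedAddCommGroup H₁] [NormedSpace ℂ H₁]
  [NormedAddCommGroup H₂] [NormedSpace ℂ H₂]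

/-- The integrated Goursat problem `∂ᵣ π = v(t + r) ε`, `∂ₜ ε = -w(t + r) π` with data
`π(0, t) = v(t)`, `ε(r, 0) = 0`. -/
structure IsGoursatSolution (v : ℝ → H₂ →L[ℂ] H₁) (w : ℝ → H₁ →L[ℂ] H₂)
    (ε : ℝ × ℝ → H₂ →L[ℂ] H₂) (π : ℝ × ℝ → H₂ →L[ℂ] H₁) : Prop where
  isLocallyBounded_left : IsLocallyBounded ε
  isLocallyBounded_right : IsLocallyBounded π
  eq_add_integral : ∀ r t, π (r, t) = v t + ∫ s in (0 : ℝ)..r, (v (t + s)).comp (ε (s, t))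
  eq_neg_integral : ∀ r t, ε (r, t) = -∫ s in (0 : ℝ)..t, (w (s + r)).comp (π (r, s))

/-- The `ε`-component of the Goursat problem determined by the `π`-component. -/
noncomputable def goursatEps (w : ℝ → H₁ →L[ℂ] H₂) (π : ℝ × ℝ → H₂ →L[ℂ] H₁)
    (p : ℝ × ℝ) : H₂ →L[ℂ] H₂ :=
  -∫ s in (0 : ℝ)..p.2, (w (s + p.1)).comp (π (p.1, s))

/-- The terms of the Picard series for the `π`-component of the Goursat problem. -/
noncomputable def goursatTerm (v : ℝ → H₂ →L[ℂ] H₁) (w : ℝ → H₁ →L[ℂ] H₂) :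
    ℕ → ℝ × ℝ → H₂ →L[ℂ] H₁
  | 0 => fun p => v p.2
  | n + 1 => fun p =>
      ∫ s in (0 : ℝ)..p.1, (v (p.2 + s)).comp (goursatEps w (goursatTerm v w n) (s, p.2))

variable {v : ℝ → H₂ →L[ℂ] H₁} {w : ℝ → H₁ →L[ℂ] H₂} {M : ℝ}

theorem isLocallyBounded_goursatEps (hw : IsLocallyBounded w) {π : ℝ × ℝ → H₂ →L[ℂ] H₁}
    (hπ : IsLocallyBounded π) : IsLocallyBounded (goursatEps w π) := by
  have hf : IsLocallyBounded fun q : (ℝ × ℝ) × ℝ => (w (q.2 + q.1.1)).comp (π (q.1.1, q.2)) :=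
    (hw.comp_continuous (by fun_prop)).clm_comp (hπ.comp_continuous (by fun_prop))
  exact (hf.parametric_intervalIntegral continuous_snd).neg

theorem isLocallyBounded_goursatTerm (hv : IsLocallyBounded v) (hw : IsLocallyBounded w) :
    ∀ n, IsLocallyBounded (goursatTerm v w n)
  | 0 => hv.comp_continuous continuous_snd
  | n + 1 => by
    have hε := isLocallyBounded_goursatEps hw (isLocallyBounded_goursatTerm hv hw n)
    have hf : IsLocallyBounded fun q : (ℝ × ℝ) × ℝ =>
        (v (q.1.2 + q.2)).comp (goursatEps w (goursatTerm v w n) (q.2, q.1.2)) :=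
      (hv.comp_continuous (by fun_prop)).clm_comp (hε.comp_continuous (by fun_prop))
    exact hf.parametric_intervalIntegral continuous_fst

theorem norm_goursatEps_le (hwM : ∀ x, ‖w x‖ ≤ M) {π : ℝ × ℝ → H₂ →L[ℂ] H₁} {r D : ℝ} {n : ℕ}
    (hπ : ∀ t, ‖π (r, t)‖ ≤ D * (|t| ^ n / n.factorial)) (t : ℝ) :
    ‖goursatEps w π (r, t)‖ ≤ M * D * (|t| ^ (n + 1) / (n + 1).factorial) := by
  rw [goursatEps, norm_neg]
  refine norm_intervalIntegral_le_pow_div_factorial fun s _ => ?_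
  rw [mul_assoc]
  exact (ContinuousLinearMap.opNorm_comp_le _ _).trans
    (mul_le_mul (hwM _) (hπ s) (norm_nonneg _) ((norm_nonneg _).trans (hwM 0)))

theorem norm_goursatTerm_le (hvM : ∀ x, ‖v x‖ ≤ M) (hwM : ∀ x, ‖w x‖ ≤ M) (n : ℕ) (r t : ℝ) :
    ‖goursatTerm v w n (r, t)‖ ≤
      M * (M ^ 2) ^ n * (|r| ^ n / n.factorial) * (|t| ^ n / n.factorial) := by
  induction n generalizing r t with
  | zero => simpa [goursatTerm] using hvM t
  | succ n ih =>
    have hterm : ‖goursatTerm v w (n + 1) (r, t)‖ ≤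
        M * (M * (M * (M ^ 2) ^ n) * (|t| ^ (n + 1) / (n + 1).factorial)) *
          (|r| ^ (n + 1) / (n + 1).factorial) := by
      refine norm_intervalIntegral_le_pow_div_factorial fun s _ => ?_
      have hε := norm_goursatEps_le hwM (ih s) t
      refine ((ContinuousLinearMap.opNorm_comp_le _ _).trans
        (mul_le_mul (hvM _) hε (norm_nonneg _) ((norm_nonneg _).trans (hvM 0)))).trans_eq ?_
      ring
    exact hterm.trans_eq (by ring)

theorem norm_goursatTerm_le_of_norm_le (hvM : ∀ x, ‖v x‖ ≤ M) (hwM : ∀ x, ‖w x‖ ≤ M) (n : ℕ)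
    {p : ℝ × ℝ} {R : ℝ} (hp : ‖p‖ ≤ R) :
    ‖goursatTerm v w n p‖ ≤ M * ((M * R) ^ 2) ^ n / n.factorial := by
  have hM : 0 ≤ M := (norm_nonneg _).trans (hvM 0)
  have hn : (1 : ℝ) ≤ n.factorial := mod_cast n.factorial_pos
  have hR : 0 ≤ R := (norm_nonneg _).trans hp
  have hr : |p.1| ≤ R := (norm_fst_le p).trans hp
  have ht : |p.2| ≤ R := (norm_snd_le p).trans hp
  calc ‖goursatTerm v w n p‖
      ≤ M * (M ^ 2) ^ n * (|p.1| ^ n / n.factorial) * (|p.2| ^ n / n.factorial) :=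
        norm_goursatTerm_le hvM hwM n p.1 p.2
    _ ≤ M * (M ^ 2) ^ n * (R ^ n / n.factorial) * (R ^ n / 1) := by gcongr
    _ = M * ((M * R) ^ 2) ^ n / n.factorial := by rw [← pow_mul, ← pow_mul, mul_pow]; ring

theorem summable_goursat_bound (M R : ℝ) :
    Summable fun n : ℕ => M * ((M * R) ^ 2) ^ n / n.factorial := by
  simpa only [mul_div_assoc] using (Real.summable_pow_div_factorial _).mul_left M

theorem norm_goursatEps_le_of_norm_le (hwM : ∀ x, ‖w x‖ ≤ M) {π : ℝ × ℝ → H₂ →L[ℂ] H₁}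
    {D R : ℝ} (hπ : ∀ p, ‖p‖ ≤ R → ‖π p‖ ≤ D) {p : ℝ × ℝ} (hp : ‖p‖ ≤ R) :
    ‖goursatEps w π p‖ ≤ M * D * R := by
  have hM : 0 ≤ M := (norm_nonneg _).trans (hwM 0)
  have hD : 0 ≤ D := (norm_nonneg _).trans (hπ p hp)
  rw [goursatEps, norm_neg]
  refine (intervalIntegral.norm_integral_le_of_norm_le_const (C := M * D) fun s hs => ?_).trans ?_
  · refine (ContinuousLinearMap.opNorm_comp_le _ _).trans
      (mul_le_mul (hwM _) (hπ _ ?_) (norm_nonneg _) hM)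
    exact (max_le_max le_rfl (abs_le_of_mem_uIoc_zero hs)).trans hp
  · rw [sub_zero]
    exact mul_le_mul_of_nonneg_left ((norm_snd_le p).trans hp) (mul_nonneg hM hD)

variable [CompleteSpace H₁]

theorem hasSum_goursatTerm (hvM : ∀ x, ‖v x‖ ≤ M) (hwM : ∀ x, ‖w x‖ ≤ M) (p : ℝ × ℝ) :
    HasSum (fun n => goursatTerm v w n p) (∑' n, goursatTerm v w n p) :=
  (Summable.of_norm_bounded (summable_goursat_bound M ‖p‖) fun n =>
    norm_goursatTerm_le_of_norm_le hvM hwM n le_rfl).hasSum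

theorem isLocallyBounded_tsum_goursatTerm (hv : IsLocallyBounded v) (hw : IsLocallyBounded w)
    (hvM : ∀ x, ‖v x‖ ≤ M) (hwM : ∀ x, ‖w x‖ ≤ M) :
    IsLocallyBounded fun p => ∑' n, goursatTerm v w n p where
  stronglyMeasurable := by
    refine stronglyMeasurable_of_tendsto Filter.atTop
      (f := fun N p => ∑ n ∈ Finset.range N, goursatTerm v w n p) (fun N => ?_)
      (tendsto_pi_nhds.2 fun p => (hasSum_goursatTerm hvM hwM p).tendsto_sum_nat)
    exact Finset.stronglyMeasurable_fun_sum _ fun n _ =>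
      (isLocallyBounded_goursatTerm hv hw n).stronglyMeasurable
  exists_bound R := ⟨_, fun _ hp => tsum_of_norm_bounded (summable_goursat_bound M R).hasSum
    fun n => norm_goursatTerm_le_of_norm_le hvM hwM n hp⟩

theorem hasSum_goursatEps (hv : IsLocallyBounded v) (hw : IsLocallyBounded w)
    (hvM : ∀ x, ‖v x‖ ≤ M) (hwM : ∀ x, ‖w x‖ ≤ M) (p : ℝ × ℝ) :
    HasSum (fun n => goursatEps w (goursatTerm v w n) p)
      (goursatEps w (fun p => ∑' n, goursatTerm v w n p) p) := by
  refine (hasSum_intervalIntegral_clm_comp (hw.comp_continuous (by fun_prop))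
    (fun n => (isLocallyBounded_goursatTerm hv hw n).comp_continuous (by fun_prop))
    (summable_goursat_bound M ‖p‖)
    (fun n s hs => norm_goursatTerm_le_of_norm_le hvM hwM n ?_)
    (fun s _ => hasSum_goursatTerm hvM hwM (p.1, s))).neg
  exact max_le_max le_rfl (abs_le_of_mem_uIoc_zero hs)

theorem exists_isGoursatSolution (hv : IsLocallyBounded v) (hw : IsLocallyBounded w)
    (hvM : ∀ x, ‖v x‖ ≤ M) (hwM : ∀ x, ‖w x‖ ≤ M) : ∃ ε π, IsGoursatSolution v w ε π := by
  let π : ℝ × ℝ → H₂ →L[ℂ] H₁ := fun p => ∑' n, goursatTerm v w n p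
  have hπ : IsLocallyBounded π := isLocallyBounded_tsum_goursatTerm hv hw hvM hwM
  refine ⟨goursatEps w π, π, isLocallyBounded_goursatEps hw hπ, hπ, fun r t => ?_, fun _ _ => rfl⟩
  have hshift : HasSum (fun n => goursatTerm v w (n + 1) (r, t))
      (∫ s in (0 : ℝ)..r, (v (t + s)).comp (goursatEps w π (s, t))) := by
    refine hasSum_intervalIntegral_clm_comp (hv.comp_continuous (by fun_prop))
      (fun n => (isLocallyBounded_goursatEps hw
        (isLocallyBounded_goursatTerm hv hw n)).comp_continuous (by fun_prop))
      (((summable_goursat_bound M ‖(r, t)‖).mul_left M).mul_right ‖(r, t)‖)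
      (fun n s hs => norm_goursatEps_le_of_norm_le hwM
        (fun p hp => norm_goursatTerm_le_of_norm_le hvM hwM n hp) ?_)
      (fun s _ => hasSum_goursatEps hv hw hvM hwM (s, t))
    exact max_le_max (abs_le_of_mem_uIoc_zero hs) le_rfl
  have hsum := (hasSum_nat_add_iff' 1).2 (hasSum_goursatTerm hvM hwM (r, t))
  rw [Finset.sum_range_one] at hsum
  exact (sub_eq_iff_eq_add').1 (hsum.unique hshift)

end Goursat

/-! ### The transmutation operator -/

/-- The Volterra operator `(N f)(x) = ∫₀ˣ k(x - t, t) f(t) dt`. -/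
noncomputable def diffKernelOp {X Y : Type*} [NormedAddCommGroup X] [NormedSpace ℂ X]
    [NormedAddCommGroup Y] [NormedSpace ℂ Y] (k : ℝ × ℝ → X →L[ℂ] Y) (f : ℝ → X) (x : ℝ) : Y :=
  ∫ t in (0 : ℝ)..x, k (x - t, t) (f t)

theorem IsLocallyBounded.diffKernelOp {X Y : Type*} [NormedAddCommGroup X] [NormedSpace ℂ X]
    [NormedAddCommGroup Y] [NormedSpace ℂ Y] {k : ℝ × ℝ → X →L[ℂ] Y} {f : ℝ → X}
    (hk : IsLocallyBounded k) (hf : IsLocallyBounded f) :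
    IsLocallyBounded (diffKernelOp k f) := by
  have hkf : IsLocallyBounded fun p : ℝ × ℝ => k (p.1 - p.2, p.2) (f p.2) :=
    (hk.comp_continuous (by fun_prop)).clm_apply (hf.comp_continuous continuous_snd)
  exact hkf.parametric_intervalIntegral continuous_id

namespace IsGoursatSolution

variable {H₁ H₂ : Type*} [NormedAddCommGroup H₁] [NormedSpace ℂ H₁]
  [NormedAddCommGroup H₂] [NormedSpace ℂ H₂]
  {v : ℝ → H₂ →L[ℂ] H₁} {w : ℝ → H₁ →L[ℂ] H₂}
  {ε : ℝ × ℝ → H₂ →L[ℂ] H₂} {π : ℝ × ℝ → H₂ →L[ℂ] H₁}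

theorem isPrimitive_left (hG : IsGoursatSolution v w ε π) (hw : IsLocallyBounded w) (r : ℝ) :
    IsPrimitive (fun t => ε (r, t)) fun t => -(w (t + r)).comp (π (r, t)) where
  isLocallyBounded := ((hw.comp_continuous (by fun_prop)).clm_comp
    (hG.isLocallyBounded_right.comp_continuous (by fun_prop))).neg
  eq_add_integral t := by
    rw [hG.eq_neg_integral r t, hG.eq_neg_integral r 0, intervalIntegral.integral_same, neg_zero,
      zero_add, intervalIntegral.integral_neg]

variable [CompleteSpace H₁] [CompleteSpace H₂]

theorem diffKernelOp_right (hG : IsGoursatSolution v w ε π) (hv : IsLocallyBounded v)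
    {g : ℝ → H₂} (hg : IsLocallyBounded g) (x : ℝ) :
    diffKernelOp π g x = ∫ s in (0 : ℝ)..x, v s (g s + diffKernelOp ε g s) := by
  have hε := hG.isLocallyBounded_left
  have hvε : IsLocallyBounded fun p : ℝ × ℝ => (v (p.2 + p.1)).comp (ε p) :=
    (hv.comp_continuous (by fun_prop)).clm_comp hε
  let f : ℝ × ℝ → H₁ := fun p => (v (p.2 + p.1)).comp (ε p) (g p.2)
  have hf : IsLocallyBounded f := hvε.clm_apply (hg.comp_continuous continuous_snd)
  have hinner : IsLocallyBounded fun t => ∫ r in (0 : ℝ)..(x - t), f (r, t) :=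
    (hf.comp_continuous (g := Prod.swap) continuous_swap).parametric_intervalIntegral (by fun_prop)
  have expand : ∀ t, π (x - t, t) (g t) = v t (g t) + ∫ r in (0 : ℝ)..(x - t), f (r, t) := by
    intro t
    rw [hG.eq_add_integral, add_apply, ContinuousLinearMap.intervalIntegral_apply]
    exact (hvε.comp_continuous (g := fun r => (r, t)) (by fun_prop)).intervalIntegrable _ _
  have diagonal : ∀ s, ∫ t in (0 : ℝ)..s, f (s - t, t) = v s (diffKernelOp ε g s) := by
    intro s
    have hεg : IsLocallyBounded fun t => ε (s - t, t) (g t) :=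
      (hε.comp_continuous (by fun_prop)).clm_apply hg
    rw [diffKernelOp, ← ContinuousLinearMap.intervalIntegral_comp_comm _
      (hεg.intervalIntegrable 0 s)]
    simp only [f, add_sub_cancel, ContinuousLinearMap.comp_apply]
  calc diffKernelOp π g x
      = ∫ t in (0 : ℝ)..x, (v t (g t) + ∫ r in (0 : ℝ)..(x - t), f (r, t)) := by
        simp only [diffKernelOp, expand]
    _ = (∫ t in (0 : ℝ)..x, v t (g t)) + ∫ s in (0 : ℝ)..x, v s (diffKernelOp ε g s) := by
        rw [intervalIntegral.integral_add ((hv.clm_apply hg).intervalIntegrable 0 x)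
          (hinner.intervalIntegrable 0 x), ← hf.integral_shear x]
        simp only [diagonal]
    _ = ∫ s in (0 : ℝ)..x, v s (g s + diffKernelOp ε g s) := by
        simp only [map_add]
        exact (intervalIntegral.integral_add ((hv.clm_apply hg).intervalIntegrable 0 x)
          ((hv.clm_apply (hε.diffKernelOp hg)).intervalIntegrable 0 x)).symm

theorem diffKernelOp_left (hG : IsGoursatSolution v w ε π) (hw : IsLocallyBounded w)
    {q g : ℝ → H₂} (hq : IsPrimitive q g) (x : ℝ) :
    diffKernelOp ε q x =
      ∫ s in (0 : ℝ)..x, (diffKernelOp ε g s - w s (diffKernelOp π q s)) := by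
  have hε := hG.isLocallyBounded_left
  have hπ := hG.isLocallyBounded_right
  have hg := hq.isLocallyBounded
  let f : ℝ × ℝ → H₂ := fun p => -(w (p.2 + p.1)).comp (π p) (q p.2) + ε p (g p.2)
  have hf : IsLocallyBounded f :=
    (((hw.comp_continuous (by fun_prop)).clm_comp hπ).neg.clm_apply
      (hq.isLocallyBounded_left.comp_continuous continuous_snd)).add
      (hε.clm_apply (hg.comp_continuous continuous_snd))
  have product : ∀ r, ε (r, x - r) (q (x - r)) = ∫ t in (0 : ℝ)..(x - r), f (r, t) := by
    intro r
    have hεr : ε (r, 0) = 0 := by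
      rw [hG.eq_neg_integral, intervalIntegral.integral_same, neg_zero]
    rw [((hG.isPrimitive_left hw r).clm_apply hq).eq_add_integral (x - r), hεr, zero_apply,
      zero_add]
    rfl
  have diagonal : ∀ s, ∫ t in (0 : ℝ)..s, f (s - t, t) =
      diffKernelOp ε g s - w s (diffKernelOp π q s) := by
    intro s
    have hεg : IsLocallyBounded fun t => ε (s - t, t) (g t) :=
      (hε.comp_continuous (by fun_prop)).clm_apply hg
    have hπq : IsLocallyBounded fun t => π (s - t, t) (q t) :=
      (hπ.comp_continuous (by fun_prop)).clm_apply hq.isLocallyBounded_left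
    rw [diffKernelOp, diffKernelOp, ← ContinuousLinearMap.intervalIntegral_comp_comm _
      (hπq.intervalIntegrable 0 s), ← intervalIntegral.integral_sub (hεg.intervalIntegrable 0 s)
      (((IsLocallyBounded.of_continuous continuous_const).clm_apply hπq).intervalIntegrable 0 s)]
    simp only [f, add_sub_cancel, ContinuousLinearMap.comp_apply, neg_add_eq_sub]
  calc diffKernelOp ε q x = ∫ r in (0 : ℝ)..x, ε (r, x - r) (q (x - r)) := by
        have hreflect :=
          intervalIntegral.integral_comp_sub_left (fun t => ε (x - t, t) (q t)) x (a := 0) (b := x)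
        simpa only [diffKernelOp, sub_sub_cancel, sub_self, sub_zero] using hreflect.symm
    _ = ∫ s in (0 : ℝ)..x, ∫ t in (0 : ℝ)..s, f (s - t, t) := by
        simp only [product]
        rw [hf.integral_shear x, hf.integral_triangle_comm x]
    _ = ∫ s in (0 : ℝ)..x, (diffKernelOp ε g s - w s (diffKernelOp π q s)) := by
        simp only [diagonal]

end IsGoursatSolution

section Dirac

variable {H₁ H₂ K : Type*} [NormedAddCommGroup H₁] [NormedSpace ℂ H₁]
  [NormedAddCommGroup H₂] [NormedSpace ℂ H₂] [NormedAddCommGroup K] [NormedSpace ℂ K]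

/-- The Dirac system at `z = 0` for the rows of the fundamental solution, `b' = v c`, `c' = -w b`,
together with a pointwise right inverse `d` of `c` annihilated by `b`. -/
structure IsDiracPair (v : ℝ → H₂ →L[ℂ] H₁) (w : ℝ → H₁ →L[ℂ] H₂)
    (b : ℝ → K →L[ℂ] H₁) (c : ℝ → K →L[ℂ] H₂) (d : ℝ → H₂ →L[ℂ] K) : Prop where
  isPrimitive_left : IsPrimitive b fun x => (v x).comp (c x)
  isPrimitive_right : IsPrimitive c fun x => -(w x).comp (b x)
  continuous_inverse : Continuous d
  left_comp_inverse : ∀ x, (b x).comp (d x) = 0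
  right_comp_inverse : ∀ x, (c x).comp (d x) = ContinuousLinearMap.id ℂ H₂

namespace IsDiracPair

variable {v : ℝ → H₂ →L[ℂ] H₁} {w : ℝ → H₁ →L[ℂ] H₂}
  {b : ℝ → K →L[ℂ] H₁} {c : ℝ → K →L[ℂ] H₂} {d : ℝ → H₂ →L[ℂ] K}

theorem volterra_eq_const (h : IsDiracPair v w b c d) {κ : K} (hκ : b 0 κ = 0) (x : ℝ) :
    c x κ = c 0 κ - ∫ s in (0 : ℝ)..x, w s (∫ t in (0 : ℝ)..s, v t (c t κ)) := by
  have left_eq : ∀ x, b x κ = ∫ t in (0 : ℝ)..x, v t (c t κ) := fun x => by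
    rw [h.isPrimitive_left.eq_add_integral x, add_apply, hκ, zero_add,
      ContinuousLinearMap.intervalIntegral_apply
        (h.isPrimitive_left.isLocallyBounded.intervalIntegrable 0 x)]
    rfl
  rw [h.isPrimitive_right.eq_add_integral x, add_apply, sub_eq_add_neg,
    ContinuousLinearMap.intervalIntegral_apply
      (h.isPrimitive_right.isLocallyBounded.intervalIntegrable 0 x),
    ← intervalIntegral.integral_neg]
  simp only [neg_apply, ContinuousLinearMap.comp_apply, left_eq]

variable [CompleteSpace H₁] [CompleteSpace H₂] [CompleteSpace K]

theorem volterra_eq (h : IsDiracPair v w b c d) {f : ℝ → H₂} (hf : IsLocallyBounded f) (x : ℝ) :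
    c x (∫ t in (0 : ℝ)..x, d t (f t)) =
      (∫ t in (0 : ℝ)..x, f t) - ∫ s in (0 : ℝ)..x,
        w s (∫ t in (0 : ℝ)..s, v t (c t (∫ t in (0 : ℝ)..t, d t (f t)))) := by
  have hF : IsPrimitive (fun x => ∫ t in (0 : ℝ)..x, d t (f t)) fun t => d t (f t) :=
    ((IsLocallyBounded.of_continuous h.continuous_inverse).clm_apply hf).isPrimitive
  have left_eq : ∀ x, b x (∫ t in (0 : ℝ)..x, d t (f t)) =
      ∫ t in (0 : ℝ)..x, v t (c t (∫ t in (0 : ℝ)..t, d t (f t))) := by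
    intro x
    rw [(h.isPrimitive_left.clm_apply hF).eq_add_integral x, intervalIntegral.integral_same,
      map_zero, zero_add]
    refine intervalIntegral.integral_congr fun t _ => ?_
    simp only [← ContinuousLinearMap.comp_apply, h.left_comp_inverse, zero_apply, add_zero]
  have hwb := h.isPrimitive_right.isLocallyBounded.clm_apply hF.isLocallyBounded_left
  have right_eq := (h.isPrimitive_right.clm_apply hF).eq_add_integral x
  simp only [← ContinuousLinearMap.comp_apply, h.right_comp_inverse] at right_eq
  rw [right_eq, intervalIntegral.integral_same, map_zero, zero_add]
  simp only [ContinuousLinearMap.id_apply]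
  rw [intervalIntegral.integral_add (hwb.intervalIntegrable 0 x) (hf.intervalIntegrable 0 x),
    add_comm, sub_eq_add_neg, ← intervalIntegral.integral_neg]
  simp only [neg_apply, ContinuousLinearMap.comp_apply, left_eq]

end IsDiracPair

variable {v : ℝ → H₂ →L[ℂ] H₁} {w : ℝ → H₁ →L[ℂ] H₂} {M : ℝ}

theorem norm_le_of_eq_neg_integral_integral (hvM : ∀ x, ‖v x‖ ≤ M) (hwM : ∀ x, ‖w x‖ ≤ M)
    {y : ℝ → H₂} (hy : ∀ x, y x = -∫ s in (0 : ℝ)..x, w s (∫ t in (0 : ℝ)..s, v t (y t)))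
    {R D : ℝ} (hD : ∀ x, |x| ≤ R → ‖y x‖ ≤ D) (n : ℕ) :
    ∀ x, |x| ≤ R → ‖y x‖ ≤ D * M ^ (2 * n) * (|x| ^ (2 * n) / (2 * n).factorial) := by
  induction n with
  | zero => simpa using hD
  | succ n ih =>
    intro x hx
    have inner : ∀ s ∈ uIoc 0 x, ‖∫ t in (0 : ℝ)..s, v t (y t)‖ ≤
        M * (D * M ^ (2 * n)) * (|s| ^ (2 * n + 1) / (2 * n + 1).factorial) := by
      intro s hs
      refine norm_intervalIntegral_le_pow_div_factorial fun t ht => ?_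
      rw [mul_assoc]
      exact (v t).le_of_opNorm_le_of_le (hvM t)
        (ih t ((abs_le_of_mem_uIoc_zero ht).trans ((abs_le_of_mem_uIoc_zero hs).trans hx)))
    have outer : ‖∫ s in (0 : ℝ)..x, w s (∫ t in (0 : ℝ)..s, v t (y t))‖ ≤
        M * (M * (D * M ^ (2 * n))) * (|x| ^ (2 * n + 1 + 1) / (2 * n + 1 + 1).factorial) := by
      refine norm_intervalIntegral_le_pow_div_factorial fun s hs => ?_
      rw [mul_assoc M]
      exact (w s).le_of_opNorm_le_of_le (hwM s) (inner s hs)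
    rw [hy x, norm_neg]
    rw [mul_add_one 2 n]
    exact outer.trans_eq (by ring)

theorem eq_of_volterra_eq (hv : IsLocallyBounded v) (hw : IsLocallyBounded w)
    (hvM : ∀ x, ‖v x‖ ≤ M) (hwM : ∀ x, ‖w x‖ ≤ M) {r y z : ℝ → H₂} (hy : IsLocallyBounded y)
    (hz : IsLocallyBounded z)
    (hyr : ∀ x, y x = r x - ∫ s in (0 : ℝ)..x, w s (∫ t in (0 : ℝ)..s, v t (y t)))
    (hzr : ∀ x, z x = r x - ∫ s in (0 : ℝ)..x, w s (∫ t in (0 : ℝ)..s, v t (z t))) : y = z := by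
  have hδ : ∀ x, y x - z x =
      -∫ s in (0 : ℝ)..x, w s (∫ t in (0 : ℝ)..s, v t (y t - z t)) := by
    intro x
    have inner : ∀ s, ∫ t in (0 : ℝ)..s, v t (y t - z t) =
        (∫ t in (0 : ℝ)..s, v t (y t)) - ∫ t in (0 : ℝ)..s, v t (z t) := fun s => by
      simp only [map_sub]
      exact intervalIntegral.integral_sub ((hv.clm_apply hy).intervalIntegrable 0 s)
        ((hv.clm_apply hz).intervalIntegrable 0 s)
    simp only [inner]
    simp only [map_sub]
    rw [intervalIntegral.integral_sub ((hw.clm_apply (hv.clm_apply hy).primitive).intervalIntegrable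
      0 x) ((hw.clm_apply (hv.clm_apply hz).primitive).intervalIntegrable 0 x)]
    conv_lhs => rw [hyr x, hzr x]
    abel
  funext x
  obtain ⟨D, hD⟩ := (hy.sub hz).exists_bound |x|
  have hlim : Filter.Tendsto
      (fun n : ℕ => D * M ^ (2 * n) * (|x| ^ (2 * n) / (2 * n).factorial))
      Filter.atTop (nhds 0) := by
    have hpow := ((FloorSemiring.tendsto_pow_div_factorial_atTop (M * |x|)).comp
      (Filter.tendsto_id.const_mul_atTop' two_pos)).const_mul D
    rw [mul_zero] at hpow
    refine hpow.congr fun n => ?_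
    simp only [Function.comp_apply, id_eq, mul_pow]
    ring
  refine sub_eq_zero.1 (norm_le_zero_iff.1 (ge_of_tendsto' hlim fun n => ?_))
  exact norm_le_of_eq_neg_integral_integral hvM hwM hδ hD n x le_rfl

theorem IsDiracPair.apply_eq_neg [CompleteSpace H₁] [CompleteSpace H₂] [CompleteSpace K]
    {b : ℝ → K →L[ℂ] H₁} {c : ℝ → K →L[ℂ] H₂} {d : ℝ → H₂ →L[ℂ] K} (h : IsDiracPair v w b c d)
    (hv : IsLocallyBounded v) (hw : IsLocallyBounded w) (hvM : ∀ x, ‖v x‖ ≤ M)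
    (hwM : ∀ x, ‖w x‖ ≤ M) {κ : K} (hκ : c 0 κ = 0) (x : ℝ) :
    c x κ = -c x (∫ t in (0 : ℝ)..x, d t (w t (b 0 κ))) := by
  set F : ℝ → K := fun x => κ + ∫ t in (0 : ℝ)..x, d t (w t (b 0 κ)) with hF_def
  have hwκ := hw.clm_apply (.of_continuous (continuous_const (y := b 0 κ)))
  have hF : IsPrimitive F fun t => d t (w t (b 0 κ)) :=
    ⟨(IsLocallyBounded.of_continuous h.continuous_inverse).clm_apply hwκ, fun x => by
      simp only [hF_def, intervalIntegral.integral_same, add_zero]⟩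
  have hF_zero : F 0 = κ := by simp only [hF_def, intervalIntegral.integral_same, add_zero]
  have hcF := h.isPrimitive_right.isLocallyBounded_left.clm_apply hF.isLocallyBounded_left
  have left_eq : ∀ x, b x (F x) = b 0 κ + ∫ t in (0 : ℝ)..x, v t (c t (F t)) := by
    intro x
    rw [(h.isPrimitive_left.clm_apply hF).eq_add_integral x, hF_zero]
    refine congrArg (b 0 κ + ·) (intervalIntegral.integral_congr fun t _ => ?_)
    simp only [← ContinuousLinearMap.comp_apply (b t), h.left_comp_inverse, zero_apply, add_zero,
      ContinuousLinearMap.comp_apply]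
  have right_eq : ∀ x, c x (F x) =
      0 - ∫ s in (0 : ℝ)..x, w s (∫ t in (0 : ℝ)..s, v t (c t (F t))) := by
    intro x
    rw [(h.isPrimitive_right.clm_apply hF).eq_add_integral x, hF_zero, hκ, zero_add, zero_sub,
      ← intervalIntegral.integral_neg]
    refine intervalIntegral.integral_congr fun t _ => ?_
    simp only [← ContinuousLinearMap.comp_apply (c t), h.right_comp_inverse, neg_apply,
      ContinuousLinearMap.comp_apply (w t), left_eq, map_add, ContinuousLinearMap.id_apply]
    abel
  have vanish := congrFun (eq_of_volterra_eq hv hw hvM hwM hcF (z := fun _ => 0)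
    (.of_continuous continuous_const) right_eq fun x => by
      simp only [map_zero, intervalIntegral.integral_zero, sub_zero]) x
  exact eq_neg_of_add_eq_zero_left ((map_add (c x) _ _).symm.trans vanish)

end Dirac

namespace IsGoursatSolution

variable {H₁ H₂ K : Type*} [NormedAddCommGroup H₁] [NormedSpace ℂ H₁] [CompleteSpace H₁]
  [NormedAddCommGroup H₂] [NormedSpace ℂ H₂] [CompleteSpace H₂]
  [NormedAddCommGroup K] [NormedSpace ℂ K]
  {v : ℝ → H₂ →L[ℂ] H₁} {w : ℝ → H₁ →L[ℂ] H₂} {M : ℝ}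
  {ε : ℝ × ℝ → H₂ →L[ℂ] H₂} {π : ℝ × ℝ → H₂ →L[ℂ] H₁}
  {b : ℝ → K →L[ℂ] H₁} {c : ℝ → K →L[ℂ] H₂} {d : ℝ → H₂ →L[ℂ] K}

theorem volterra_eq (hG : IsGoursatSolution v w ε π) (hv : IsLocallyBounded v)
    (hw : IsLocallyBounded w) {q g : ℝ → H₂} (hq : IsPrimitive q g) (x : ℝ) :
    q x + diffKernelOp ε q x = (q 0 + ∫ t in (0 : ℝ)..x, (g t + diffKernelOp ε g t)) -
      ∫ s in (0 : ℝ)..x, w s (∫ t in (0 : ℝ)..s, v t (q t + diffKernelOp ε q t)) := by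
  have hg := hq.isLocallyBounded
  have hεg := hG.isLocallyBounded_left.diffKernelOp hg
  have hπq := hw.clm_apply (hG.isLocallyBounded_right.diffKernelOp hq.isLocallyBounded_left)
  simp only [← hG.diffKernelOp_right hv hq.isLocallyBounded_left]
  rw [hG.diffKernelOp_left hw hq x, hq.eq_add_integral x,
    intervalIntegral.integral_sub (hεg.intervalIntegrable 0 x) (hπq.intervalIntegrable 0 x),
    intervalIntegral.integral_add (hg.intervalIntegrable 0 x) (hεg.intervalIntegrable 0 x)]
  abel

theorem add_diffKernelOp_const (hG : IsGoursatSolution v w ε π) (h : IsDiracPair v w b c d)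
    (hv : IsLocallyBounded v) (hw : IsLocallyBounded w) (hvM : ∀ x, ‖v x‖ ≤ M)
    (hwM : ∀ x, ‖w x‖ ≤ M) {κ : K} (hκ : b 0 κ = 0) (x : ℝ) :
    c 0 κ + diffKernelOp ε (fun _ => c 0 κ) x = c x κ := by
  have hconst : IsPrimitive (fun _ : ℝ => c 0 κ) fun _ => 0 :=
    ⟨.of_continuous continuous_const, fun x => by rw [intervalIntegral.integral_zero, add_zero]⟩
  refine congrFun (eq_of_volterra_eq hv hw hvM hwM
    (hconst.isLocallyBounded_left.add
      (hG.isLocallyBounded_left.diffKernelOp hconst.isLocallyBounded_left))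
    (h.isPrimitive_right.isLocallyBounded_left.clm_apply (.of_continuous continuous_const))
    (hG.volterra_eq hv hw hconst) fun x => ?_) x
  simpa only [diffKernelOp, map_zero, add_zero, intervalIntegral.integral_zero]
    using h.volterra_eq_const hκ x

variable [CompleteSpace K]

theorem add_diffKernelOp_integral (hG : IsGoursatSolution v w ε π) (h : IsDiracPair v w b c d)
    (hv : IsLocallyBounded v) (hw : IsLocallyBounded w) (hvM : ∀ x, ‖v x‖ ≤ M)
    (hwM : ∀ x, ‖w x‖ ≤ M) {g : ℝ → H₂} (hg : IsLocallyBounded g) (x : ℝ) :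
    (∫ t in (0 : ℝ)..x, g t) + diffKernelOp ε (fun x => ∫ t in (0 : ℝ)..x, g t) x =
      c x (∫ t in (0 : ℝ)..x, d t (g t + diffKernelOp ε g t)) := by
  have hEg := hg.add (hG.isLocallyBounded_left.diffKernelOp hg)
  have hF := ((IsLocallyBounded.of_continuous h.continuous_inverse).clm_apply hEg).primitive
  refine congrFun (eq_of_volterra_eq hv hw hvM hwM
    (hg.primitive.add (hG.isLocallyBounded_left.diffKernelOp hg.primitive))
    (h.isPrimitive_right.isLocallyBounded_left.clm_apply hF)
    (fun x => hG.volterra_eq hv hw hg.isPrimitive x) fun x => ?_) x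
  rw [h.volterra_eq hEg x, intervalIntegral.integral_same, zero_add]

end IsGoursatSolution

/-! ### Volterra operators in `L²(0, l)` -/

theorem intervalIntegral_congr_ae_Ioo {E : Type*} [NormedAddCommGroup E] [NormedSpace ℝ E]
    {f g : ℝ → E} {l : ℝ} (h : f =ᵐ[volume.restrict (Ioo 0 l)] g) {x : ℝ} (hx : x ∈ Icc 0 l) :
    ∫ t in (0 : ℝ)..x, f t = ∫ t in (0 : ℝ)..x, g t := by
  refine intervalIntegral.integral_congr_ae_restrict ?_
  rw [uIoc_of_le hx.1, ← restrict_Ioo_eq_restrict_Ioc]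
  exact ae_restrict_of_ae_restrict_of_subset (Ioo_subset_Ioo_right hx.2) h

section IntegralNorm

variable {H : Type*} [NormedAddCommGroup H] {l : ℝ}

theorem intervalIntegrable_Lp_two (f : Lp H 2 (volume.restrict (Ioo 0 l))) {x : ℝ}
    (hx : x ∈ Icc 0 l) : IntervalIntegrable f volume 0 x := by
  rw [intervalIntegrable_iff_integrableOn_Ioo_of_le hx.1]
  exact IntegrableOn.mono_set ((Lp.memLp f).integrable one_le_two) (Ioo_subset_Ioo_right hx.2)

theorem integral_norm_Lp_two_mono (f : Lp H 2 (volume.restrict (Ioo 0 l))) {x : ℝ}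
    (hx : x ∈ Icc 0 l) : ∫ t in (0 : ℝ)..x, ‖f t‖ ≤ ∫ t in (0 : ℝ)..l, ‖f t‖ :=
  intervalIntegral.integral_mono_interval le_rfl hx.1 hx.2 (.of_forall fun _ => norm_nonneg _)
    (intervalIntegrable_Lp_two f ⟨hx.1.trans hx.2, le_rfl⟩).norm

theorem exists_integral_norm_le_mul_norm (hl : 0 ≤ l) :
    ∃ D : ℝ, 0 ≤ D ∧ ∀ f : Lp H 2 (volume.restrict (Ioo 0 l)),
      ∫ t in (0 : ℝ)..l, ‖f t‖ ≤ D * ‖f‖ := by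
  set μ := volume.restrict (Ioo 0 l)
  refine ⟨(μ univ ^ (1 / (1 : ENNReal).toReal - 1 / (2 : ENNReal).toReal)).toReal,
    ENNReal.toReal_nonneg, fun f => ?_⟩
  rw [intervalIntegral.integral_of_le hl, ← restrict_Ioo_eq_restrict_Ioc,
    integral_norm_eq_lintegral_enorm (Lp.aestronglyMeasurable f), ← eLpNorm_one_eq_lintegral_enorm,
    Lp.norm_def, mul_comm, ← ENNReal.toReal_mul]
  exact ENNReal.toReal_mono (ENNReal.mul_ne_top (Lp.eLpNorm_ne_top f)
    (ENNReal.rpow_ne_top_of_nonneg (by norm_num) (measure_ne_top _ _)))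
    (eLpNorm_le_eLpNorm_mul_rpow_measure_univ one_le_two (Lp.aestronglyMeasurable f))

end IntegralNorm

theorem isUnit_one_sub_of_norm_pow_lt_one {R : Type*} [NormedRing R] [HasSummableGeomSeries R]
    {x : R} {n : ℕ} (h : ‖x ^ n‖ < 1) : IsUnit (1 - x) := by
  have hunit := isUnit_one_sub_of_norm_lt_one h
  have hcomm : Commute (1 - x) (∑ i ∈ Finset.range n, x ^ i) :=
    (mul_neg_geom_sum x n).trans (geom_sum_mul_neg x n).symm
  rw [← mul_neg_geom_sum] at hunit
  exact (hcomm.isUnit_mul_iff.1 hunit).1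

section Iteration

variable {H : Type*} [NormedAddCommGroup H] {l C : ℝ}

theorem norm_le_of_le_intervalIntegral (hC : 0 ≤ C) {f : ℕ → ℝ → H}
    (hf : ∀ n, IntervalIntegrable (f n) volume 0 l)
    (hle : ∀ n, ∀ᵐ x ∂volume.restrict (Ioo 0 l), ‖f (n + 1) x‖ ≤ C * ∫ t in (0 : ℝ)..x, ‖f n t‖)
    (n : ℕ) : ∀ᵐ x ∂volume.restrict (Ioo 0 l), ‖f (n + 1) x‖ ≤
      C ^ (n + 1) * (∫ t in (0 : ℝ)..l, ‖f 0 t‖) * (x ^ n / n.factorial) := by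
  induction n with
  | zero =>
    filter_upwards [hle 0, ae_restrict_mem measurableSet_Ioo] with x hx hxl
    have hmono : ∫ t in (0 : ℝ)..x, ‖f 0 t‖ ≤ ∫ t in (0 : ℝ)..l, ‖f 0 t‖ :=
      intervalIntegral.integral_mono_interval le_rfl hxl.1.le hxl.2.le
        (.of_forall fun _ => norm_nonneg _) (hf 0).norm
    simpa using hx.trans (mul_le_mul_of_nonneg_left hmono hC)
  | succ n ih =>
    filter_upwards [hle (n + 1), ae_restrict_mem measurableSet_Ioo] with x hx hxl
    have hmono : ∫ t in (0 : ℝ)..x, ‖f (n + 1) t‖ ≤ ∫ t in (0 : ℝ)..x,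
        C ^ (n + 1) * (∫ t in (0 : ℝ)..l, ‖f 0 t‖) * (t ^ n / n.factorial) := by
      refine intervalIntegral.integral_mono_ae_restrict hxl.1.le
        ((hf (n + 1)).mono_set (uIcc_subset_uIcc_left ?_)).norm
        (Continuous.intervalIntegrable (by fun_prop) _ _) ?_
      · rw [uIcc_of_le (hxl.1.trans hxl.2).le]
        exact Ioo_subset_Icc_self hxl
      · rw [← restrict_Ioo_eq_restrict_Icc]
        exact ae_restrict_of_ae_restrict_of_subset (Ioo_subset_Ioo_right hxl.2.le) ih
    refine (hx.trans (mul_le_mul_of_nonneg_left hmono hC)).trans_eq ?_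
    rw [intervalIntegral.integral_const_mul, intervalIntegral.integral_div, integral_pow,
      Nat.factorial_succ, Nat.cast_mul, Nat.cast_succ]
    field_simp
    ring

theorem ae_eq_zero_of_le_intervalIntegral (hC : 0 ≤ C) {f : ℝ → H}
    (hf : IntervalIntegrable f volume 0 l)
    (hle : ∀ᵐ x ∂volume.restrict (Ioo 0 l), ‖f x‖ ≤ C * ∫ t in (0 : ℝ)..x, ‖f t‖) :
    ∀ᵐ x ∂volume.restrict (Ioo 0 l), f x = 0 := by
  have hbound := norm_le_of_le_intervalIntegral hC (f := fun _ => f) (fun _ => hf) fun _ => hle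
  filter_upwards [ae_all_iff.2 hbound] with x hx
  have hlim := (FloorSemiring.tendsto_pow_div_factorial_atTop (C * x)).const_mul
    (C * ∫ t in (0 : ℝ)..l, ‖f t‖)
  rw [mul_zero] at hlim
  exact norm_le_zero_iff.1 (ge_of_tendsto' hlim fun n => (hx n).trans_eq (by ring))

end Iteration

section OneSub

variable {H : Type*} [NormedAddCommGroup H] [NormedSpace ℂ H] {l C : ℝ}
  {N : Lp H 2 (volume.restrict (Ioo 0 l)) →L[ℂ] Lp H 2 (volume.restrict (Ioo 0 l))}

theorem exists_norm_pow_succ_le_of_le_intervalIntegral (hl : 0 ≤ l) (hC : 0 ≤ C)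
    (hN : ∀ f, ∀ᵐ x ∂volume.restrict (Ioo 0 l), ‖N f x‖ ≤ C * ∫ t in (0 : ℝ)..x, ‖f t‖) :
    ∃ B : ℝ, ∀ n : ℕ, ‖N ^ (n + 1)‖ ≤ B * ((C * l) ^ n / n.factorial) := by
  obtain ⟨D, hD, hfD⟩ := exists_integral_norm_le_mul_norm (H := H) hl
  refine ⟨(measureUnivNNReal (volume.restrict (Ioo 0 l)) : ℝ) ^ (2 : ENNReal).toReal⁻¹ * (C * D),
    fun n => ContinuousLinearMap.opNorm_le_bound _ (by positivity) fun f => ?_⟩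
  refine (Lp.norm_le_of_ae_bound (C := C ^ (n + 1) * (D * ‖f‖) * (l ^ n / n.factorial))
    (by positivity) ?_).trans_eq (by ring)
  have hiterate := norm_le_of_le_intervalIntegral hC (f := fun n => (N ^ n) f)
    (fun n => intervalIntegrable_Lp_two _ (right_mem_Icc.2 hl)) fun n => by
      rw [pow_succ']
      exact hN ((N ^ n) f)
  filter_upwards [hiterate n, ae_restrict_mem measurableSet_Ioo] with x hx hxl
  have hx0 := hxl.1.le
  have hxl' := hxl.2.le
  refine hx.trans ?_
  gcongr
  exact hfD f

theorem isUnit_one_sub_of_le_intervalIntegral [CompleteSpace H] (hl : 0 ≤ l) (hC : 0 ≤ C)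
    (hN : ∀ f, ∀ᵐ x ∂volume.restrict (Ioo 0 l), ‖N f x‖ ≤ C * ∫ t in (0 : ℝ)..x, ‖f t‖) :
    IsUnit (1 - N) := by
  obtain ⟨B, hB⟩ := exists_norm_pow_succ_le_of_le_intervalIntegral hl hC hN
  have hlim : Filter.Tendsto (fun n : ℕ => B * ((C * l) ^ n / n.factorial)) Filter.atTop
      (nhds 0) := by
    simpa only [mul_zero] using
      (FloorSemiring.tendsto_pow_div_factorial_atTop (C * l)).const_mul B
  obtain ⟨n, hn⟩ := (hlim.eventually (gt_mem_nhds one_pos)).exists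
  exact isUnit_one_sub_of_norm_pow_lt_one ((hB n).trans_lt hn)

end OneSub

section Volterra

variable {X Y : Type*} [NormedAddCommGroup X] [NormedSpace ℂ X] [NormedAddCommGroup Y]
  [NormedSpace ℂ Y] {k : ℝ → ℝ → X →L[ℂ] Y} {C l : ℝ}

theorem norm_volterra_le (hkC : ∀ x t, ‖k x t‖ ≤ C) {f : ℝ → X} {x : ℝ} (hx : 0 ≤ x)
    (hf : IntervalIntegrable f volume 0 x) (y : ℝ) :
    ‖∫ t in (0 : ℝ)..x, k y t (f t)‖ ≤ C * ∫ t in (0 : ℝ)..x, ‖f t‖ := by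
  rw [← intervalIntegral.integral_const_mul]
  exact intervalIntegral.norm_integral_le_of_norm_le hx
    (.of_forall fun t _ => (k y t).le_of_opNorm_le (hkC y t) (f t)) (hf.norm.const_mul C)

theorem intervalIntegrable_volterra (hk : StronglyMeasurable (Function.uncurry k))
    (hkC : ∀ x t, ‖k x t‖ ≤ C) {f : ℝ → X} {x : ℝ} (hf : IntervalIntegrable f volume 0 x) (y : ℝ) :
    IntervalIntegrable (fun t => k y t (f t)) volume 0 x := by
  have hky : StronglyMeasurable (k y) := hk.comp_measurable measurable_prodMk_left
  exact (hf.norm.const_mul C).mono_fun'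
    (isBoundedBilinearMap_apply.continuous.comp_aestronglyMeasurable
      (hky.aestronglyMeasurable.prodMk hf.def'.aestronglyMeasurable))
    (.of_forall fun t => (k y t).le_of_opNorm_le (hkC y t) (f t))

theorem memLp_volterra (hk : StronglyMeasurable (Function.uncurry k)) (hkC : ∀ x t, ‖k x t‖ ≤ C)
    (hC : 0 ≤ C) (f : Lp X 2 (volume.restrict (Ioo 0 l))) :
    MemLp (fun x => ∫ t in (0 : ℝ)..x, k x t (f t)) 2 (volume.restrict (Ioo 0 l)) := by
  refine MemLp.of_bound ?_ (C * ∫ t in (0 : ℝ)..l, ‖f t‖) ?_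
  · exact (stronglyMeasurable_intervalIntegral (f := fun x t => k x t (f t))
      (isBoundedBilinearMap_apply.continuous.comp_stronglyMeasurable
        (hk.prodMk ((Lp.stronglyMeasurable f).comp_measurable measurable_snd)))
      measurable_const measurable_id).aestronglyMeasurable
  · filter_upwards [ae_restrict_mem measurableSet_Ioo] with x hx
    have hx' := Ioo_subset_Icc_self hx
    exact (norm_volterra_le hkC hx'.1 (intervalIntegrable_Lp_two f hx') x).trans
      (mul_le_mul_of_nonneg_left (integral_norm_Lp_two_mono f hx') hC)

theorem volterra_add (hk : StronglyMeasurable (Function.uncurry k)) (hkC : ∀ x t, ‖k x t‖ ≤ C)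
    (f g : Lp X 2 (volume.restrict (Ioo 0 l))) {x : ℝ} (hx : x ∈ Icc 0 l) :
    ∫ t in (0 : ℝ)..x, k x t ((f + g) t) =
      (∫ t in (0 : ℝ)..x, k x t (f t)) + ∫ t in (0 : ℝ)..x, k x t (g t) := by
  rw [← intervalIntegral.integral_add
    (intervalIntegrable_volterra hk hkC (intervalIntegrable_Lp_two f hx) x)
    (intervalIntegrable_volterra hk hkC (intervalIntegrable_Lp_two g hx) x)]
  refine intervalIntegral_congr_ae_Ioo ((Lp.coeFn_add f g).mono fun t ht => ?_) hx
  simp only [ht, Pi.add_apply, map_add]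

theorem volterra_smul (k : ℝ → ℝ → X →L[ℂ] Y) (c : ℂ)
    (f : Lp X 2 (volume.restrict (Ioo 0 l))) {x : ℝ} (hx : x ∈ Icc 0 l) :
    ∫ t in (0 : ℝ)..x, k x t ((c • f) t) = c • ∫ t in (0 : ℝ)..x, k x t (f t) := by
  rw [← intervalIntegral.integral_smul]
  refine intervalIntegral_congr_ae_Ioo ((Lp.coeFn_smul c f).mono fun t ht => ?_) hx
  simp only [ht, Pi.smul_apply, map_smul]

theorem exists_volterra_clm (hl : 0 ≤ l) (hk : StronglyMeasurable (Function.uncurry k))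
    (hkC : ∀ x t, ‖k x t‖ ≤ C) :
    ∃ N : Lp X 2 (volume.restrict (Ioo 0 l)) →L[ℂ] Lp Y 2 (volume.restrict (Ioo 0 l)),
      ∀ f, ∀ᵐ x ∂volume.restrict (Ioo 0 l), N f x = ∫ t in (0 : ℝ)..x, k x t (f t) := by
  set μ := volume.restrict (Ioo 0 l)
  have hC : 0 ≤ C := (norm_nonneg _).trans (hkC 0 0)
  have hmem : ∀ f : Lp X 2 μ, MemLp (fun x => ∫ t in (0 : ℝ)..x, k x t (f t)) 2 μ :=
    memLp_volterra hk hkC hC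
  let N₀ : Lp X 2 μ →ₗ[ℂ] Lp Y 2 μ :=
    { toFun := fun f => (hmem f).toLp _
      map_add' := fun f g => by
        rw [← MemLp.toLp_add]
        refine MemLp.toLp_congr _ _ ?_
        filter_upwards [ae_restrict_mem measurableSet_Ioo] with x hx
        exact volterra_add hk hkC f g (Ioo_subset_Icc_self hx)
      map_smul' := fun c f => by
        rw [RingHom.id_apply, ← MemLp.toLp_const_smul]
        refine MemLp.toLp_congr _ _ ?_
        filter_upwards [ae_restrict_mem measurableSet_Ioo] with x hx
        exact volterra_smul k c f (Ioo_subset_Icc_self hx) }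
  obtain ⟨D, hD, hfD⟩ := exists_integral_norm_le_mul_norm (H := X) hl
  refine ⟨N₀.mkContinuous ((measureUnivNNReal μ : ℝ) ^ (2 : ENNReal).toReal⁻¹ * (C * D))
    fun f => ?_, fun f => (hmem f).coeFn_toLp⟩
  rw [mul_assoc, mul_assoc]
  refine Lp.norm_le_of_ae_bound (by positivity) ?_
  filter_upwards [(hmem f).coeFn_toLp, ae_restrict_mem measurableSet_Ioo] with x hfx hx
  have hx' := Ioo_subset_Icc_self hx
  refine (congrArg norm hfx).trans_le ((norm_volterra_le hkC hx'.1
    (intervalIntegrable_Lp_two f hx') x).trans (mul_le_mul_of_nonneg_left ?_ hC))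
  exact (integral_norm_Lp_two_mono f hx').trans (hfD f)

end Volterra

/-! ### Matrices as operators -/

section MatCLM

variable {m n p : Type*} [Fintype m] [Fintype n] [DecidableEq n]

/-- The identification of matrices with operators between Euclidean spaces, isometric for the
`L²` operator norm. -/
noncomputable def matCLM :
    Matrix m n ℂ ≃ₗᵢ[ℂ] (EuclideanSpace ℂ n →L[ℂ] EuclideanSpace ℂ m) where
  toLinearEquiv := Matrix.toEuclideanLin.trans LinearMap.toContinuousLinearMap
  norm_map' _ := rfl

theorem matCLM_apply (A : Matrix m n ℂ) (x : EuclideanSpace ℂ n) :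
    matCLM A x = WithLp.toLp 2 (A *ᵥ x.ofLp) := rfl

theorem matCLM_mul [Fintype p] [DecidableEq m] (A : Matrix p m ℂ) (B : Matrix m n ℂ) :
    matCLM (A * B) = (matCLM A).comp (matCLM B) := by
  ext1 x
  simp [matCLM_apply, Matrix.mulVec_mulVec]

theorem matCLM_one : matCLM (1 : Matrix n n ℂ) = ContinuousLinearMap.id ℂ _ := by
  ext1 x
  simp [matCLM_apply]

theorem toEuclideanCLM_eq_matCLM (A : Matrix n n ℂ) :
    Matrix.toEuclideanCLM (𝕜 := ℂ) A = matCLM A := rfl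

theorem matCLM_single (A : Matrix m n ℂ) (k : n) :
    matCLM A (EuclideanSpace.single k 1) = WithLp.toLp 2 fun i => A i k := by
  ext i
  rw [matCLM_apply]
  simp

theorem norm_toLp_col_le (A : Matrix m n ℂ) (k : n) :
    ‖(WithLp.toLp 2 fun i => A i k : EuclideanSpace ℂ m)‖ ≤ ‖A‖ := by
  rw [← matCLM_single, ← matCLM.norm_map A]
  simpa using (matCLM A).le_opNorm (EuclideanSpace.single k 1)

end MatCLM

theorem continuous_toLp_col {m n : Type*} (k : n) :
    Continuous fun A : Matrix m n ℂ => (WithLp.toLp 2 fun i => A i k : EuclideanSpace ℂ m) :=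
  (PiLp.continuous_toLp 2 _).comp (continuous_pi fun i => continuous_id.matrix_elem i k)

section Columns

variable {p q : ℕ} {μ : Measure ℝ} {Ψ : ℝ → Matrix (Fin p) (Fin q) ℂ} {k : Fin q}

theorem column_eq_of_ae_eq {f : Lp (EuclideanSpace ℂ (Fin p)) 2 μ}
    (hf : f =ᵐ[μ] fun t => WithLp.toLp 2 fun i => Ψ t i k) : column μ Ψ k = f := by
  have hmem : MemLp (fun t => (WithLp.toLp 2 fun i => Ψ t i k : EuclideanSpace ℂ (Fin p))) 2 μ :=
    (memLp_congr_ae hf).1 (Lp.memLp f)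
  rw [column, dif_pos hmem]
  exact Lp.ext (hmem.coeFn_toLp.trans hf.symm)

theorem coeFn_column_of_bound [IsFiniteMeasure μ] (hΨ : AEStronglyMeasurable Ψ μ) {C : ℝ}
    (hC : ∀ᵐ x ∂μ, ‖Ψ x‖ ≤ C) (k : Fin q) :
    column μ Ψ k =ᵐ[μ] fun t => WithLp.toLp 2 fun i => Ψ t i k := by
  have hmem : MemLp (fun t => (WithLp.toLp 2 fun i => Ψ t i k : EuclideanSpace ℂ (Fin p))) 2 μ :=
    MemLp.of_bound ((continuous_toLp_col k).comp_aestronglyMeasurable hΨ) C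
      (hC.mono fun x hx => (norm_toLp_col_le _ _).trans hx)
  rw [column, dif_pos hmem]
  exact hmem.coeFn_toLp

/-- The matrix with given columns, as a continuous linear map. -/
noncomputable def ofColumnsCLM (p q : ℕ) :
    (Fin q → EuclideanSpace ℂ (Fin p)) →L[ℂ] Matrix (Fin p) (Fin q) ℂ :=
  LinearMap.toContinuousLinearMap
    { toFun := fun f => Matrix.of fun i k => f k i
      map_add' := fun _ _ => rfl
      map_smul' := fun _ _ => rfl }

variable {T : Lp (EuclideanSpace ℂ (Fin p)) 2 μ →L[ℂ] Lp (EuclideanSpace ℂ (Fin p)) 2 μ}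

theorem applyColumns_eq_ofColumnsCLM :
    applyColumns T Ψ = fun t => ofColumnsCLM p q fun k => T (column μ Ψ k) t := rfl

theorem applyColumns_ae_eq {Θ : ℝ → Matrix (Fin p) (Fin q) ℂ}
    (h : ∀ k, T (column μ Ψ k) =ᵐ[μ] fun t => WithLp.toLp 2 fun i => Θ t i k) :
    applyColumns T Ψ =ᵐ[μ] Θ := by
  filter_upwards [ae_all_iff.2 h] with x hx
  ext i k
  exact congrArg (fun y : EuclideanSpace ℂ (Fin p) => y i) (hx k)

theorem stronglyMeasurable_applyColumns : StronglyMeasurable (applyColumns T Ψ) := by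
  rw [applyColumns_eq_ofColumnsCLM]
  refine (ofColumnsCLM p q).continuous.comp_stronglyMeasurable ?_
  exact (measurable_pi_lambda _ fun k => (Lp.stronglyMeasurable _).measurable).stronglyMeasurable

theorem exists_ae_norm_applyColumns_le
    (h : ∀ k, ∃ D, ∀ᵐ x ∂μ, ‖T (column μ Ψ k) x‖ ≤ D) :
    ∃ C, ∀ᵐ x ∂μ, ‖applyColumns T Ψ x‖ ≤ C := by
  choose D hD using h
  refine ⟨‖ofColumnsCLM p q‖ * ∑ k, |D k|, ?_⟩
  filter_upwards [ae_all_iff.2 hD] with x hx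
  rw [applyColumns_eq_ofColumnsCLM]
  refine (ofColumnsCLM p q).le_opNorm_of_le ?_
  refine (pi_norm_le_iff_of_nonneg (Finset.sum_nonneg fun k _ => abs_nonneg _)).2 fun k => ?_
  exact ((hx k).trans (le_abs_self _)).trans
    (Finset.single_le_sum (f := fun k => |D k|) (fun k _ => abs_nonneg _) (Finset.mem_univ k))

end Columns

section Entries

variable {m n : Type*} [Fintype m] [Fintype n] [DecidableEq n] {F : ℝ → Matrix m n ℂ}

theorem integrable_of_entries {μ : Measure ℝ} (h : ∀ i j, Integrable (fun t => F t i j) μ) :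
    Integrable F μ := by
  classical
  have hF : F = fun t => ∑ i, ∑ j, F t i j • (Matrix.single i j 1 : Matrix m n ℂ) := by
    funext t
    conv_lhs => rw [Matrix.matrix_eq_sum_single (F t)]
    simp [Matrix.smul_single]
  rw [hF]
  exact integrable_finsetSum _ fun i _ => integrable_finsetSum _ fun j _ => (h i j).smul_const _

theorem integral_entry {μ : Measure ℝ} (hF : Integrable F μ) (i : m) (j : n) :
    (∫ t, F t ∂μ) i j = ∫ t, F t i j ∂μ :=
  ((LinearMap.toContinuousLinearMap (Matrix.entryLinearMap ℂ ℂ i j)).integral_comp_comm hF).symm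

end Entries

/-! ### The Dirac system at `z = 0` -/

/-- A strongly measurable function bounded by `M` and extended by zero off `(0, l)`, the form in
which potentials are handled. -/
structure IsBoundedPotential {X : Type*} [NormedAddCommGroup X] (l M : ℝ) (v : ℝ → X) : Prop where
  stronglyMeasurable : StronglyMeasurable v
  norm_le : ∀ x, ‖v x‖ ≤ M
  eq_zero : ∀ x ∉ Ioo 0 l, v x = 0

namespace IsBoundedPotential

variable {X Y : Type*} [NormedAddCommGroup X] [NormedAddCommGroup Y] {l M : ℝ}

theorem isLocallyBounded {v : ℝ → X} (hv : IsBoundedPotential l M v) : IsLocallyBounded v :=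
  .of_bound hv.stronglyMeasurable hv.norm_le

theorem comp {v : ℝ → X} (hv : IsBoundedPotential l M v) {φ : X → Y} (hφ : Continuous φ)
    (hφ_norm : ∀ A, ‖φ A‖ = ‖A‖) : IsBoundedPotential l M fun x => φ (v x) where
  stronglyMeasurable := hφ.comp_stronglyMeasurable hv.stronglyMeasurable
  norm_le x := (hφ_norm _).trans_le (hv.norm_le x)
  eq_zero x hx := norm_eq_zero.1 (by rw [hφ_norm, hv.eq_zero x hx, norm_zero])

end IsBoundedPotential

theorem exists_isBoundedPotential {X : Type*} [NormedAddCommGroup X] {l M : ℝ} (hM0 : 0 ≤ M)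
    {v : ℝ → X} (hv : AEStronglyMeasurable v (volume.restrict (Ioo 0 l)))
    (hM : ∀ᵐ x ∂volume.restrict (Ioo 0 l), ‖v x‖ ≤ M) :
    ∃ v', IsBoundedPotential l M v' ∧ v =ᵐ[volume.restrict (Ioo 0 l)] v' := by
  let s : Set ℝ := Ioo 0 l ∩ {x | ‖hv.mk v x‖ ≤ M}
  have hs : MeasurableSet s := measurableSet_Ioo.inter
    (measurableSet_le hv.stronglyMeasurable_mk.norm.measurable measurable_const)
  refine ⟨s.indicator (hv.mk v), ⟨hv.stronglyMeasurable_mk.indicator hs, fun x => ?_,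
    fun x hx => indicator_of_notMem (fun hxs => hx hxs.1) _⟩, ?_⟩
  · by_cases hx : x ∈ s
    · rw [indicator_of_mem hx]
      exact hx.2
    · rwa [indicator_of_notMem hx, norm_zero]
  · filter_upwards [hv.ae_eq_mk, hM, ae_restrict_mem measurableSet_Ioo] with x hx hMx hxl
    have hxs : x ∈ s := ⟨hxl, by rwa [mem_ofPred_eq, ← hx]⟩
    rw [indicator_of_mem hxs, hx]

section Dirac

variable {m₁ m₂ : ℕ} {l M : ℝ} {v : ℝ → Matrix (Fin m₁) (Fin m₂) ℂ}
  {u : ℝ → ℂ → Matrix (Fin m₁ ⊕ Fin m₂) (Fin m₁ ⊕ Fin m₂) ℂ}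

theorem jMat_mul_vMat (a : Matrix (Fin m₁) (Fin m₂) ℂ) :
    jMat m₁ m₂ * vMat a = Matrix.fromBlocks 0 a (-aᴴ) 0 := by
  simp [jMat, vMat, Matrix.fromBlocks_multiply]

theorem conjTranspose_jMat_mul_vMat (a : Matrix (Fin m₁) (Fin m₂) ℂ) :
    (jMat m₁ m₂ * vMat a)ᴴ = -(jMat m₁ m₂ * vMat a) := by
  rw [jMat_mul_vMat, Matrix.fromBlocks_conjTranspose, Matrix.fromBlocks_neg]
  simp

theorem fromCols_mul_jMat_mul_vMat {n : Type*} (A : Matrix n (Fin m₁) ℂ) (B : Matrix n (Fin m₂) ℂ)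
    (a : Matrix (Fin m₁) (Fin m₂) ℂ) :
    Matrix.fromCols A B * (jMat m₁ m₂ * vMat a) = Matrix.fromCols (-(B * aᴴ)) (A * a) := by
  simp [jMat_mul_vMat, Matrix.fromCols_mul_fromBlocks]

-- The product in the definition of `beta` and `gamma` elaborates to the one of `CStarMatrix`;
-- these lemmas expose it as a product of matrices.
theorem beta_eq (x : ℝ) :
    beta u x = (Matrix.fromCols 1 0 : Matrix (Fin m₁) (Fin m₁ ⊕ Fin m₂) ℂ) * u x 0 := rfl

theorem gamma_eq (x : ℝ) :
    gamma u x = (Matrix.fromCols 0 1 : Matrix (Fin m₂) (Fin m₁ ⊕ Fin m₂) ℂ) * u x 0 := rfl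

theorem lipschitzWith_mul_left {m n p : Type*} [Fintype m] [Fintype n] [Fintype p] [DecidableEq m]
    [DecidableEq n] (A : Matrix p m ℂ) :
    LipschitzWith ‖A‖₊ fun B : Matrix m n ℂ => A * B :=
  LipschitzWith.of_dist_le_mul fun B C => by
    rw [dist_eq_norm, dist_eq_norm, ← Matrix.mul_sub]
    exact Matrix.l2_opNorm_mul _ _

theorem hasDerivAt_mul_left {m n p : Type*} [Fintype m] [Finite n] [Finite p]
    (A : Matrix p m ℂ) {F : ℝ → Matrix m n ℂ} {F' : Matrix m n ℂ} {x : ℝ}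
    (hF : HasDerivAt F F' x) : HasDerivAt (fun x => A * F x) (A * F') x := by
  classical
  cases nonempty_fintype n
  cases nonempty_fintype p
  exact (LinearMap.toContinuousLinearMap
    (mulLeftLinearMap n ℝ A)).hasFDerivAt.comp_hasDerivAt x hF

theorem hasDerivAt_matCLM {m n : Type*} [Fintype m] [Fintype n] [DecidableEq n]
    {F : ℝ → Matrix m n ℂ} {F' : Matrix m n ℂ} {x : ℝ} (hF : HasDerivAt F F' x) :
    HasDerivAt (fun x => matCLM (F x)) (matCLM F') x := by
  let L : Matrix m n ℂ →L[ℝ] EuclideanSpace ℂ n →L[ℂ] EuclideanSpace ℂ m :=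
    matCLM.toContinuousLinearEquiv.toContinuousLinearMap.restrictScalars ℝ
  exact L.hasFDerivAt.comp_hasDerivAt x hF

theorem norm_matCLM_conjTranspose {m n : Type*} [Fintype m] [Fintype n] [DecidableEq m]
    [DecidableEq n] (A : Matrix m n ℂ) : ‖matCLM Aᴴ‖ = ‖A‖ := by
  rw [matCLM.norm_map, Matrix.l2_opNorm_conjTranspose]

theorem IsBoundedPotential.matCLM_comp (hv : IsBoundedPotential l M v) :
    IsBoundedPotential l M fun x => matCLM (v x) :=
  hv.comp matCLM.continuous matCLM.norm_map

theorem IsBoundedPotential.matCLM_conjTranspose_comp (hv : IsBoundedPotential l M v) :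
    IsBoundedPotential l M fun x => matCLM (v x)ᴴ :=
  hv.comp (matCLM.continuous.comp continuous_id.matrix_conjTranspose) norm_matCLM_conjTranspose

theorem isometry_conjTranspose {m n : Type*} [Fintype m] [Fintype n] [DecidableEq m]
    [DecidableEq n] : Isometry fun A : Matrix m n ℂ => Aᴴ :=
  Isometry.of_dist_eq fun A B => by
    rw [dist_eq_norm, dist_eq_norm, ← Matrix.conjTranspose_sub, Matrix.l2_opNorm_conjTranspose]

namespace IsFundamentalSolution

theorem congr {w : ℝ → Matrix (Fin m₁) (Fin m₂) ℂ} (hu : IsFundamentalSolution l v u)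
    (h : v =ᵐ[volume.restrict (Ioo 0 l)] w) : IsFundamentalSolution l w u where
  absCont := hu.absCont
  initial := hu.initial
  ode z := by
    filter_upwards [hu.ode z, h] with x hx hvw
    rwa [hvw] at hx

theorem hasDerivAt_zero (hu : IsFundamentalSolution l v u) :
    ∀ᵐ x ∂volume.restrict (Ioo 0 l),
      HasDerivAt (fun x => u x 0) (jMat m₁ m₂ * vMat (v x) * u x 0) x := by
  filter_upwards [hu.ode 0] with x hx
  simpa using hx

theorem hasDerivAt_beta (hu : IsFundamentalSolution l v u) :
    ∀ᵐ x ∂volume.restrict (Ioo 0 l), HasDerivAt (beta u) (v x * gamma u x) x := by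
  filter_upwards [hu.hasDerivAt_zero] with x hx
  convert! hasDerivAt_mul_left (Matrix.fromCols 1 0 : Matrix (Fin m₁) (Fin m₁ ⊕ Fin m₂) ℂ) hx
    using 1
  rw [gamma_eq, ← Matrix.mul_assoc, ← Matrix.mul_assoc, fromCols_mul_jMat_mul_vMat,
    Matrix.mul_fromCols]
  simp

theorem hasDerivAt_gamma (hu : IsFundamentalSolution l v u) :
    ∀ᵐ x ∂volume.restrict (Ioo 0 l), HasDerivAt (gamma u) (-((v x)ᴴ * beta u x)) x := by
  filter_upwards [hu.hasDerivAt_zero] with x hx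
  convert! hasDerivAt_mul_left (Matrix.fromCols 0 1 : Matrix (Fin m₂) (Fin m₁ ⊕ Fin m₂) ℂ) hx
    using 1
  rw [beta_eq, ← Matrix.mul_assoc, ← Matrix.mul_assoc, fromCols_mul_jMat_mul_vMat,
    Matrix.mul_fromCols, ← Matrix.neg_mul]
  congr 1
  ext i (j | j) <;> simp

theorem absolutelyContinuousOnInterval_beta (hu : IsFundamentalSolution l v u) :
    AbsolutelyContinuousOnInterval (beta u) 0 l :=
  absolutelyContinuousOnInterval_lipschitz_comp (lipschitzWith_mul_left _) (hu.absCont 0)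

theorem absolutelyContinuousOnInterval_gamma (hu : IsFundamentalSolution l v u) :
    AbsolutelyContinuousOnInterval (gamma u) 0 l :=
  absolutelyContinuousOnInterval_lipschitz_comp (lipschitzWith_mul_left _) (hu.absCont 0)

theorem beta_zero (hu : IsFundamentalSolution l v u) : beta u 0 = Matrix.fromCols 1 0 := by
  rw [beta_eq, hu.initial, Matrix.mul_one]

theorem gamma_zero (hu : IsFundamentalSolution l v u) : gamma u 0 = Matrix.fromCols 0 1 := by
  rw [gamma_eq, hu.initial, Matrix.mul_one]

theorem mul_conjTranspose_self (hl : 0 ≤ l) (hu : IsFundamentalSolution l v u) {x : ℝ}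
    (hx : x ∈ Icc 0 l) : u x 0 * (u x 0)ᴴ = 1 := by
  have hstar : AbsolutelyContinuousOnInterval (fun x => (u x 0)ᴴ) 0 l :=
    absolutelyContinuousOnInterval_lipschitz_comp isometry_conjTranspose.lipschitz (hu.absCont 0)
  have hac := absolutelyContinuousOnInterval_mul hstar (hu.absCont 0)
  have hder : ∀ᵐ x, x ∈ uIcc 0 l → HasDerivAt (fun x => (u x 0)ᴴ * u x 0) 0 x := by
    rw [← ae_restrict_iff' measurableSet_uIcc, uIcc_of_le hl, ← restrict_Ioo_eq_restrict_Icc]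
    filter_upwards [hu.hasDerivAt_zero] with x hx
    have hstar : HasDerivAt (fun x => (u x 0)ᴴ) ((jMat m₁ m₂ * vMat (v x) * u x 0)ᴴ) x := hx.star
    convert! hstar.mul hx using 1
    rw [Matrix.conjTranspose_mul, conjTranspose_jMat_mul_vMat]
    simp [Matrix.mul_assoc]
  obtain ⟨c, hc⟩ := hac.const_of_ae_hasDerivAt_zero hder
  have hc0 := hc 0 left_mem_uIcc
  rw [hu.initial 0, Matrix.conjTranspose_one, one_mul] at hc0
  exact mul_eq_one_comm.1 ((hc x (by rwa [uIcc_of_le hl])).trans hc0.symm)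

theorem gamma_mul_conjTranspose_gamma (hl : 0 ≤ l) (hu : IsFundamentalSolution l v u) {x : ℝ}
    (hx : x ∈ Icc 0 l) : gamma u x * (gamma u x)ᴴ = 1 := by
  rw [gamma_eq, Matrix.conjTranspose_mul, Matrix.mul_assoc, ← Matrix.mul_assoc (u x 0),
    hu.mul_conjTranspose_self hl hx, Matrix.one_mul,
    Matrix.conjTranspose_fromCols_eq_fromRows_conjTranspose, Matrix.fromCols_mul_fromRows]
  simp

theorem beta_mul_conjTranspose_gamma (hl : 0 ≤ l) (hu : IsFundamentalSolution l v u) {x : ℝ}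
    (hx : x ∈ Icc 0 l) : beta u x * (gamma u x)ᴴ = 0 := by
  rw [gamma_eq, beta_eq, Matrix.conjTranspose_mul, Matrix.mul_assoc, ← Matrix.mul_assoc (u x 0),
    hu.mul_conjTranspose_self hl hx, Matrix.one_mul,
    Matrix.conjTranspose_fromCols_eq_fromRows_conjTranspose, Matrix.fromCols_mul_fromRows]
  simp

theorem deriv_gamma_mul_conjTranspose_gamma (hl : 0 ≤ l) (hu : IsFundamentalSolution l v u) :
    ∀ᵐ x ∂volume.restrict (Ioo 0 l), deriv (gamma u) x * (gamma u x)ᴴ = 0 := by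
  filter_upwards [hu.hasDerivAt_gamma, ae_restrict_mem measurableSet_Ioo] with x hx hxl
  rw [hx.deriv, Matrix.neg_mul, Matrix.mul_assoc,
    hu.beta_mul_conjTranspose_gamma hl (Ioo_subset_Icc_self hxl), Matrix.mul_zero, neg_zero]

theorem continuous_beta_projIcc (hl : 0 ≤ l) (hu : IsFundamentalSolution l v u) :
    Continuous fun x => beta u (projIcc 0 l hl x) :=
  hu.absolutelyContinuousOnInterval_beta.continuousOn.comp_continuous
    (continuous_subtype_val.comp continuous_projIcc)
    fun x => by rw [uIcc_of_le hl]; exact (projIcc 0 l hl x).2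

theorem continuous_gamma_projIcc (hl : 0 ≤ l) (hu : IsFundamentalSolution l v u) :
    Continuous fun x => gamma u (projIcc 0 l hl x) :=
  hu.absolutelyContinuousOnInterval_gamma.continuousOn.comp_continuous
    (continuous_subtype_val.comp continuous_projIcc)
    fun x => by rw [uIcc_of_le hl]; exact (projIcc 0 l hl x).2

theorem isDiracPair (hl : 0 ≤ l) (hu : IsFundamentalSolution l v u)
    (hv : IsBoundedPotential l M v) :
    IsDiracPair (fun x => matCLM (v x)) (fun x => matCLM (v x)ᴴ)
      (fun x => matCLM (beta u (projIcc 0 l hl x))) (fun x => matCLM (gamma u (projIcc 0 l hl x)))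
      (fun x => matCLM (gamma u (projIcc 0 l hl x))ᴴ) where
  isPrimitive_left := by
    refine .of_ae_hasDerivAt_projIcc (F := fun x => matCLM (beta u x)) hl
      (absolutelyContinuousOnInterval_lipschitz_comp matCLM.lipschitz
        hu.absolutelyContinuousOnInterval_beta) ?_ (fun x hx => ?_) ?_
    · exact hv.matCLM_comp.isLocallyBounded.clm_comp
        (.of_continuous (matCLM.continuous.comp (hu.continuous_gamma_projIcc hl)))
    · rw [hv.eq_zero x hx, map_zero, ContinuousLinearMap.zero_comp]
    · filter_upwards [hu.hasDerivAt_beta, ae_restrict_mem measurableSet_Ioo] with x hx hxl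
      rw [projIcc_of_mem hl (Ioo_subset_Icc_self hxl), ← matCLM_mul]
      exact hasDerivAt_matCLM hx
  isPrimitive_right := by
    refine .of_ae_hasDerivAt_projIcc (F := fun x => matCLM (gamma u x)) hl
      (absolutelyContinuousOnInterval_lipschitz_comp matCLM.lipschitz
        hu.absolutelyContinuousOnInterval_gamma) ?_ (fun x hx => ?_) ?_
    · exact hv.matCLM_conjTranspose_comp.isLocallyBounded.clm_comp
        (.of_continuous (matCLM.continuous.comp (hu.continuous_beta_projIcc hl))) |>.neg
    · rw [hv.eq_zero x hx, Matrix.conjTranspose_zero, map_zero,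
        ContinuousLinearMap.zero_comp, neg_zero]
    · filter_upwards [hu.hasDerivAt_gamma, ae_restrict_mem measurableSet_Ioo] with x hx hxl
      rw [projIcc_of_mem hl (Ioo_subset_Icc_self hxl), ← matCLM_mul, ← map_neg]
      exact hasDerivAt_matCLM hx
  continuous_inverse := matCLM.continuous.comp (hu.continuous_gamma_projIcc hl).matrix_conjTranspose
  left_comp_inverse x := by
    rw [← matCLM_mul, hu.beta_mul_conjTranspose_gamma hl (projIcc 0 l hl x).2, map_zero]
  right_comp_inverse x := by
    rw [← matCLM_mul, hu.gamma_mul_conjTranspose_gamma hl (projIcc 0 l hl x).2, matCLM_one]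

end IsFundamentalSolution

end Dirac

/-! ### Existence of a normalized similarity operator -/

theorem IsLocallyBounded.exists_bounded_kernel {X : Type*} [NormedAddCommGroup X]
    {K : ℝ × ℝ → X} (hK : IsLocallyBounded K) (l : ℝ) :
    ∃ (k : ℝ → ℝ → X) (C : ℝ), StronglyMeasurable (Function.uncurry k) ∧ (∀ x t, ‖k x t‖ ≤ C) ∧
      ∀ x ∈ Icc 0 l, ∀ t ∈ Icc 0 x, k x t = K (x, t) := by
  have hs : IsCompact (Icc 0 l ×ˢ Icc 0 l) := isCompact_Icc.prod isCompact_Icc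
  obtain ⟨R, hR⟩ := hs.isBounded.exists_norm_le
  obtain ⟨C, hC⟩ := hK.exists_bound R
  refine ⟨fun x t => (Icc 0 l ×ˢ Icc 0 l).indicator K (x, t), max C 0,
    hK.stronglyMeasurable.indicator hs.measurableSet, fun x t => ?_, fun x hx t ht => ?_⟩
  · by_cases h : (x, t) ∈ Icc 0 l ×ˢ Icc 0 l
    · exact (congrArg norm (indicator_of_mem h K)).trans_le
        ((hC _ (hR _ h)).trans (le_max_left _ _))
    · exact (congrArg norm (indicator_of_notMem h K)).trans_le
        (norm_zero.trans_le (le_max_right _ _))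
  · have hxt : (x, t) ∈ Icc 0 l ×ˢ Icc 0 l := ⟨hx, ht.1, ht.2.trans hx.2⟩
    exact indicator_of_mem hxt K

section Volterra

variable {X Y : Type*} [NormedAddCommGroup X] [NormedSpace ℂ X] [NormedAddCommGroup Y]
  [NormedSpace ℂ Y] {l : ℝ}

theorem intervalIntegral_kernel_congr {k : ℝ → ℝ → X →L[ℂ] Y} {K : ℝ × ℝ → X →L[ℂ] Y}
    (hkK : ∀ x ∈ Icc 0 l, ∀ t ∈ Icc 0 x, k x t = K (x, t)) (f : ℝ → X) {x : ℝ}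
    (hx : x ∈ Icc 0 l) :
    ∫ t in (0 : ℝ)..x, k x t (f t) = ∫ t in (0 : ℝ)..x, K (x, t) (f t) :=
  intervalIntegral.integral_congr fun t ht => by
    rw [uIcc_of_le hx.1] at ht
    simp only [hkK x hx t ht]

theorem exists_continuousLinearEquiv_add_volterra [CompleteSpace X] {k : ℝ → ℝ → X →L[ℂ] X} {C : ℝ}
    (hl : 0 ≤ l) (hk : StronglyMeasurable (Function.uncurry k)) (hkC : ∀ x t, ‖k x t‖ ≤ C) :
    ∃ E : Lp X 2 (volume.restrict (Ioo 0 l)) ≃L[ℂ] Lp X 2 (volume.restrict (Ioo 0 l)),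
      ∀ f, ∀ᵐ x ∂volume.restrict (Ioo 0 l), E f x = f x + ∫ t in (0 : ℝ)..x, k x t (f t) := by
  obtain ⟨N, hN⟩ := exists_volterra_clm hl hk hkC
  have hunit : IsUnit (1 - -N) := by
    refine isUnit_one_sub_of_le_intervalIntegral hl ((norm_nonneg _).trans (hkC 0 0)) fun f => ?_
    filter_upwards [hN f, Lp.coeFn_neg (N f), ae_restrict_mem measurableSet_Ioo] with x hx hneg hxl
    rw [neg_apply, hneg, Pi.neg_apply, norm_neg, hx]
    exact norm_volterra_le hkC hxl.1.le (intervalIntegrable_Lp_two f (Ioo_subset_Icc_self hxl)) x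
  obtain ⟨U, hU⟩ := hunit
  refine ⟨ContinuousLinearEquiv.ofUnit U, fun f => ?_⟩
  have hE : ContinuousLinearEquiv.ofUnit U f = f + N f := by
    rw [show f + N f = (1 - -N) f by rw [sub_neg_eq_add]; rfl, ← hU]
    rfl
  rw [hE]
  filter_upwards [Lp.coeFn_add f (N f), hN f] with x hadd hx
  rw [hadd, Pi.add_apply, hx]

theorem diffKernelOp_congr_ae (k : ℝ × ℝ → X →L[ℂ] Y) {f g : ℝ → X}
    (h : f =ᵐ[volume.restrict (Ioo 0 l)] g) {x : ℝ} (hx : x ∈ Icc 0 l) :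
    diffKernelOp k f x = diffKernelOp k g x :=
  intervalIntegral_congr_ae_Ioo (h.mono fun t ht => by simp only [ht]) hx

theorem ext_of_isLocallyBounded {μ : Measure ℝ} {p : ENNReal} [Fact (1 ≤ p)] (hp : p ≠ ⊤)
    {Z : Type*} [NormedAddCommGroup Z] [NormedSpace ℂ Z] {S T : Lp X p μ →L[ℂ] Z}
    (h : ∀ (f : Lp X p μ) (g : ℝ → X), IsLocallyBounded g → f =ᵐ[μ] g → S f = T f) : S = T := by
  refine DFunLike.coe_injective ((Lp.simpleFunc.denseRange hp).equalizer S.continuous T.continuous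
    (funext fun f => h f _ ?_ (Lp.simpleFunc.toSimpleFunc_eq_toFun f).symm))
  obtain ⟨C, hC⟩ := (Lp.simpleFunc.toSimpleFunc f).exists_forall_norm_le
  exact .of_bound (SimpleFunc.stronglyMeasurable _) hC

end Volterra

theorem IsGoursatSolution.comp_eq_comp {H₁ H₂ K : Type*} [NormedAddCommGroup H₁]
    [NormedSpace ℂ H₁] [CompleteSpace H₁] [NormedAddCommGroup H₂] [NormedSpace ℂ H₂]
    [CompleteSpace H₂] [NormedAddCommGroup K] [NormedSpace ℂ K] [CompleteSpace K]
    {v : ℝ → H₂ →L[ℂ] H₁} {w : ℝ → H₁ →L[ℂ] H₂} {M l : ℝ}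
    {ε : ℝ × ℝ → H₂ →L[ℂ] H₂} {π : ℝ × ℝ → H₂ →L[ℂ] H₁}
    {b : ℝ → K →L[ℂ] H₁} {c : ℝ → K →L[ℂ] H₂} {d : ℝ → H₂ →L[ℂ] K}
    (hG : IsGoursatSolution v w ε π) (h : IsDiracPair v w b c d)
    (hv : IsLocallyBounded v) (hw : IsLocallyBounded w) (hvM : ∀ x, ‖v x‖ ≤ M)
    (hwM : ∀ x, ‖w x‖ ≤ M)
    {E A T : Lp H₂ 2 (volume.restrict (Ioo 0 l)) →L[ℂ] Lp H₂ 2 (volume.restrict (Ioo 0 l))}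
    (hE : ∀ f, ∀ᵐ x ∂volume.restrict (Ioo 0 l), E f x = f x + diffKernelOp ε f x)
    (hA : ∀ f, ∀ᵐ x ∂volume.restrict (Ioo 0 l), A f x = ∫ t in (0 : ℝ)..x, f t)
    (hT : ∀ f, ∀ᵐ x ∂volume.restrict (Ioo 0 l), T f x = ∫ t in (0 : ℝ)..x, c x (d t (f t))) :
    E ∘L A = T ∘L E := by
  refine ext_of_isLocallyBounded ENNReal.ofNat_ne_top fun f g hg hfg => Lp.ext ?_
  have hA_ae : A f =ᵐ[volume.restrict (Ioo 0 l)] fun x => ∫ t in (0 : ℝ)..x, g t := by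
    filter_upwards [hA f, ae_restrict_mem measurableSet_Ioo] with x hx hxl
    rw [hx, intervalIntegral_congr_ae_Ioo hfg (Ioo_subset_Icc_self hxl)]
  have hE_ae : E f =ᵐ[volume.restrict (Ioo 0 l)] fun t => g t + diffKernelOp ε g t := by
    filter_upwards [hE f, hfg, ae_restrict_mem measurableSet_Ioo] with t ht htg htl
    rw [ht, htg, diffKernelOp_congr_ae ε hfg (Ioo_subset_Icc_self htl)]
  filter_upwards [hE (A f), hT (E f), hA_ae, ae_restrict_mem measurableSet_Ioo]
    with x hEA hTE hAx hxl
  have hx := Ioo_subset_Icc_self hxl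
  have hcd : ∫ t in (0 : ℝ)..x, c x (d t (E f t)) =
      ∫ t in (0 : ℝ)..x, c x (d t (g t + diffKernelOp ε g t)) :=
    intervalIntegral_congr_ae_Ioo (hE_ae.mono fun t ht => by simp only [ht]) hx
  have hdEg := (IsLocallyBounded.of_continuous h.continuous_inverse).clm_apply
    (hg.add (hG.isLocallyBounded_left.diffKernelOp hg))
  rw [ContinuousLinearMap.comp_apply, ContinuousLinearMap.comp_apply, hEA, hTE, hAx,
    diffKernelOp_congr_ae ε hA_ae hx, hG.add_diffKernelOp_integral h hv hw hvM hwM hg, hcd,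
    ContinuousLinearMap.intervalIntegral_comp_comm _ (hdEg.intervalIntegrable 0 x)]

theorem exists_integration_clm (X : Type*) [NormedAddCommGroup X] [NormedSpace ℂ X] {l : ℝ}
    (hl : 0 ≤ l) :
    ∃ A : Lp X 2 (volume.restrict (Ioo 0 l)) →L[ℂ] Lp X 2 (volume.restrict (Ioo 0 l)),
      ∀ f, ∀ᵐ x ∂volume.restrict (Ioo 0 l), A f x = ∫ t in (0 : ℝ)..x, f t :=
  exists_volterra_clm (k := fun _ _ => ContinuousLinearMap.id ℂ X) hl stronglyMeasurable_const
    fun _ _ => ContinuousLinearMap.norm_id_le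

theorem IsDiracPair.exists_clm {H₁ H₂ K : Type*} [NormedAddCommGroup H₁] [NormedSpace ℂ H₁]
    [NormedAddCommGroup H₂] [NormedSpace ℂ H₂] [NormedAddCommGroup K] [NormedSpace ℂ K]
    {v : ℝ → H₂ →L[ℂ] H₁} {w : ℝ → H₁ →L[ℂ] H₂}
    {b : ℝ → K →L[ℂ] H₁} {c : ℝ → K →L[ℂ] H₂} {d : ℝ → H₂ →L[ℂ] K} {l : ℝ}
    (h : IsDiracPair v w b c d) (hl : 0 ≤ l) :
    ∃ T : Lp H₂ 2 (volume.restrict (Ioo 0 l)) →L[ℂ] Lp H₂ 2 (volume.restrict (Ioo 0 l)),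
      ∀ f, ∀ᵐ x ∂volume.restrict (Ioo 0 l), T f x = ∫ t in (0 : ℝ)..x, c x (d t (f t)) := by
  have hcd : IsLocallyBounded fun p : ℝ × ℝ => (c p.1).comp (d p.2) :=
    (h.isPrimitive_right.isLocallyBounded_left.comp_continuous continuous_fst).clm_comp
      ((IsLocallyBounded.of_continuous h.continuous_inverse).comp_continuous continuous_snd)
  obtain ⟨k, C, hk, hkC, hkcd⟩ := hcd.exists_bounded_kernel l
  obtain ⟨T, hT⟩ := exists_volterra_clm hl hk hkC
  refine ⟨T, fun f => ?_⟩
  filter_upwards [hT f, ae_restrict_mem measurableSet_Ioo] with x hx hxl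
  rw [hx, intervalIntegral_kernel_congr (K := fun p => (c p.1).comp (d p.2)) hkcd f
    (Ioo_subset_Icc_self hxl)]
  rfl

section Dirac

variable {m₁ m₂ : ℕ} {l M : ℝ} {v : ℝ → Matrix (Fin m₁) (Fin m₂) ℂ}
  {u : ℝ → ℂ → Matrix (Fin m₁ ⊕ Fin m₂) (Fin m₁ ⊕ Fin m₂) ℂ} {E : L2 m₂ l ≃L[ℂ] L2 m₂ l}

theorem isIntegration_smul {n : ℕ} {A : L2 n l →L[ℂ] L2 n l}
    (hA : ∀ f, ∀ᵐ x ∂volume.restrict (Ioo 0 l), A f x = ∫ t in (0 : ℝ)..x, f t) :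
    IsIntegration ((-Complex.I) • A) := fun f => by
  filter_upwards [hA f, Lp.coeFn_smul (-Complex.I) (A f)] with x hx hsmul
  rw [smul_apply, hsmul, Pi.smul_apply, hx]

theorem isVolterra_smul {n : ℕ} {ι : Type} [Fintype ι] [DecidableEq ι]
    {F : ℝ → Matrix (Fin n) ι ℂ} {G : ℝ → Matrix ι (Fin n) ℂ} (hl : 0 ≤ l) (z : ℂ)
    {T : L2 n l →L[ℂ] L2 n l}
    (hT : ∀ f, ∀ᵐ x ∂volume.restrict (Ioo 0 l), T f x = ∫ t in (0 : ℝ)..x,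
      matCLM (F (projIcc 0 l hl x)) (matCLM (G (projIcc 0 l hl t)) (f t))) :
    IsVolterra F (fun t => z • G t) (z • T) := fun f => by
  filter_upwards [hT f, Lp.coeFn_smul z (T f), ae_restrict_mem measurableSet_Ioo]
    with x hx hsmul hxl
  rw [smul_apply, hsmul, Pi.smul_apply, hx, ← intervalIntegral.integral_smul]
  refine intervalIntegral.integral_congr fun t ht => ?_
  rw [uIcc_of_le hxl.1.le] at ht
  simp only [projIcc_of_mem hl (Ioo_subset_Icc_self hxl),
    projIcc_of_mem hl (⟨ht.1, ht.2.trans hxl.2.le⟩ : t ∈ Icc 0 l), toEuclideanCLM_eq_matCLM,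
    matCLM_mul, map_smul, ContinuousLinearMap.comp_apply, smul_apply]

theorem applyColumns_symm_eq_one {n : ℕ} {E : L2 n l ≃L[ℂ] L2 n l}
    {ε : ℝ × ℝ → EuclideanSpace ℂ (Fin n) →L[ℂ] EuclideanSpace ℂ (Fin n)}
    {Γ : ℝ → Matrix (Fin n) (Fin n) ℂ}
    (hE : ∀ f, ∀ᵐ x ∂volume.restrict (Ioo 0 l), E f x = f x + diffKernelOp ε f x)
    (hε : ∀ k, ∀ x ∈ Icc 0 l, EuclideanSpace.single k 1 +
      diffKernelOp ε (fun _ => EuclideanSpace.single k 1) x = WithLp.toLp 2 fun i => Γ x i k) :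
    ∀ᵐ x ∂volume.restrict (Ioo 0 l), applyColumns (E.symm : L2 n l →L[ℂ] L2 n l) Γ x = 1 := by
  refine applyColumns_ae_eq (Θ := fun _ => 1) fun k => ?_
  let f : L2 n l := Lp.const 2 _ (EuclideanSpace.single k 1)
  have hf : f =ᵐ[volume.restrict (Ioo 0 l)] fun _ => EuclideanSpace.single k 1 := Lp.coeFn_const ..
  have hEf : column (volume.restrict (Ioo 0 l)) Γ k = E f := by
    refine column_eq_of_ae_eq ?_
    filter_upwards [hE f, hf, ae_restrict_mem measurableSet_Ioo] with x hx hfx hxl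
    rw [hx, hfx, diffKernelOp_congr_ae ε hf (Ioo_subset_Icc_self hxl),
      hε k x (Ioo_subset_Icc_self hxl)]
  rw [hEf, ContinuousLinearEquiv.coe_coe, E.symm_apply_apply]
  filter_upwards [hf] with x hx
  rw [hx]
  ext i
  simp [Matrix.one_apply]

namespace IsFundamentalSolution

theorem matCLM_beta_zero_single_inr (hu : IsFundamentalSolution l v u) (k : Fin m₂) :
    matCLM (beta u 0) (EuclideanSpace.single (Sum.inr k) 1) = 0 := by
  rw [matCLM_single, hu.beta_zero]
  ext
  simp

theorem matCLM_gamma_zero_single_inr (hu : IsFundamentalSolution l v u) (k : Fin m₂) :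
    matCLM (gamma u 0) (EuclideanSpace.single (Sum.inr k) 1) = EuclideanSpace.single k 1 := by
  rw [matCLM_single, hu.gamma_zero]
  ext i
  simp [Matrix.one_apply]

theorem isSimilarity (hl : 0 ≤ l) (hu : IsFundamentalSolution l v u)
    {k : ℝ → ℝ → EuclideanSpace ℂ (Fin m₂) →L[ℂ] EuclideanSpace ℂ (Fin m₂)} {C : ℝ}
    (hk : StronglyMeasurable (Function.uncurry k)) (hkC : ∀ x t, ‖k x t‖ ≤ C)
    {A T : L2 m₂ l →L[ℂ] L2 m₂ l}
    (hE : ∀ f, ∀ᵐ x ∂volume.restrict (Ioo 0 l), E f x = f x + ∫ t in (0 : ℝ)..x, k x t (f t))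
    (hA : ∀ f, ∀ᵐ x ∂volume.restrict (Ioo 0 l), A f x = ∫ t in (0 : ℝ)..x, f t)
    (hT : ∀ f, ∀ᵐ x ∂volume.restrict (Ioo 0 l), T f x = ∫ t in (0 : ℝ)..x,
      matCLM (gamma u (projIcc 0 l hl x)) (matCLM (gamma u (projIcc 0 l hl t))ᴴ (f t)))
    (hEA : (E : L2 m₂ l →L[ℂ] L2 m₂ l) ∘L A = T ∘L (E : L2 m₂ l →L[ℂ] L2 m₂ l)) :
    IsSimilarity (gamma u) (fun t => (-Complex.I) • (gamma u t)ᴴ) E := by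
  refine ⟨⟨(-Complex.I) • A, (-Complex.I) • T, isIntegration_smul hA,
    isVolterra_smul (G := fun t => (gamma u t)ᴴ) hl _ hT, ?_⟩, fun _ => 1,
    fun x t => matCLM.symm (k x t), ?_, ?_, ?_, ?_, ?_, fun f => ?_⟩
  · rw [ContinuousLinearMap.smul_comp, ContinuousLinearMap.comp_smul,
      ← ContinuousLinearMap.comp_assoc, hEA]
    ext1 f
    simp
  · exact (LipschitzWith.const 1).lipschitzOnWith.absolutelyContinuousOnInterval
  · filter_upwards [hu.deriv_gamma_mul_conjTranspose_gamma hl] with x hx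
    simpa [hx] using hasDerivAt_const x (1 : Matrix (Fin m₂) (Fin m₂) ℂ)
  · simp
  · exact matCLM.symm.continuous.comp_stronglyMeasurable hk
  · exact ⟨C, fun x t => (matCLM.symm.norm_map _).trans_le (hkC x t)⟩
  · filter_upwards [hE f] with x hx
    simp only [hx, toEuclideanCLM_eq_matCLM, LinearIsometryEquiv.apply_symm_apply, matCLM_one,
      ContinuousLinearMap.id_apply]

theorem exists_isNormalizedSimilarity (hl : 0 ≤ l) (hu : IsFundamentalSolution l v u)
    (hv : IsBoundedPotential l M v) :
    ∃ E : L2 m₂ l ≃L[ℂ] L2 m₂ l, IsNormalizedSimilarity (gamma u) E := by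
  have hD := hu.isDiracPair hl hv
  have hv' := hv.matCLM_comp
  have hw' := hv.matCLM_conjTranspose_comp
  obtain ⟨ε, π, hG⟩ := exists_isGoursatSolution hv'.isLocallyBounded hw'.isLocallyBounded
    hv'.norm_le hw'.norm_le
  have hε : IsLocallyBounded fun p : ℝ × ℝ => ε (p.1 - p.2, p.2) :=
    hG.isLocallyBounded_left.comp_continuous (by fun_prop)
  obtain ⟨k, C, hk, hkC, hkε⟩ := hε.exists_bounded_kernel l
  obtain ⟨E, hE⟩ := exists_continuousLinearEquiv_add_volterra hl hk hkC
  have hEε : ∀ f, ∀ᵐ x ∂volume.restrict (Ioo 0 l), E f x = f x + diffKernelOp ε f x := by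
    intro f
    filter_upwards [hE f, ae_restrict_mem measurableSet_Ioo] with x hx hxl
    rw [hx]
    exact congrArg (f x + ·) (intervalIntegral_kernel_congr (K := fun p => ε (p.1 - p.2, p.2))
      hkε f (Ioo_subset_Icc_self hxl))
  obtain ⟨A, hA⟩ := exists_integration_clm (EuclideanSpace ℂ (Fin m₂)) hl
  obtain ⟨T, hT⟩ := hD.exists_clm hl
  have hEA : (E : L2 m₂ l →L[ℂ] L2 m₂ l) ∘L A = T ∘L (E : L2 m₂ l →L[ℂ] L2 m₂ l) :=
    hG.comp_eq_comp hD hv'.isLocallyBounded hw'.isLocallyBounded hv'.norm_le hw'.norm_le hEε hA hT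
  refine ⟨E, hu.isSimilarity hl hk hkC hE hA hT hEA,
    applyColumns_symm_eq_one hEε fun k x hx => ?_⟩
  have h := hG.add_diffKernelOp_const hD hv'.isLocallyBounded hw'.isLocallyBounded hv'.norm_le
    hw'.norm_le (κ := EuclideanSpace.single (Sum.inr k) 1)
    (by simpa using hu.matCLM_beta_zero_single_inr k) x
  simp only [projIcc_of_mem hl hx, projIcc_left, hu.matCLM_gamma_zero_single_inr] at h
  exact h.trans (matCLM_single _ _)

end IsFundamentalSolution

end Dirac

/-! ### Compressions of triangular operators -/

section Compression

variable {X Y : Type*} [NormedAddCommGroup X] [InnerProductSpace ℂ X] [CompleteSpace X]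
  [NormedAddCommGroup Y] [InnerProductSpace ℂ Y] [CompleteSpace Y]

open ContinuousLinearMap

/-- The compression `P T P*` of an operator `T`; here `P` will be a coisometry. -/
noncomputable def compression (P : X →L[ℂ] Y) (T : X →L[ℂ] X) : Y →L[ℂ] Y :=
  P ∘L T ∘L adjoint P

theorem compression_one {P : X →L[ℂ] Y} (hP : P ∘L adjoint P = 1) : compression P 1 = 1 := hP

theorem adjoint_compression (P : X →L[ℂ] Y) (T : X →L[ℂ] X) :
    adjoint (compression P T) = compression P (adjoint T) := by
  simp only [compression, adjoint_comp, adjoint_adjoint, ContinuousLinearMap.comp_assoc]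

theorem compression_apply_of_ker {P : X →L[ℂ] Y} (hP : P ∘L adjoint P = 1) {T : X →L[ℂ] X}
    (hT : ∀ f, P f = 0 → P (T f) = 0) (f : X) : compression P T (P f) = P (T f) := by
  have hPP : P (adjoint P (P f)) = P f := DFunLike.congr_fun hP (P f)
  have hker : P (f - adjoint P (P f)) = 0 := by rw [map_sub, hPP, sub_self]
  have himage := hT _ hker
  rw [map_sub, map_sub, sub_eq_zero] at himage
  exact himage.symm

theorem compression_mul_of_ker {P : X →L[ℂ] Y} (hP : P ∘L adjoint P = 1) {T : X →L[ℂ] X}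
    (hT : ∀ f, P f = 0 → P (T f) = 0) (S : X →L[ℂ] X) :
    compression P (T * S) = compression P T * compression P S := by
  ext1 y
  exact (compression_apply_of_ker hP hT _).symm

section Equiv

variable {P : X →L[ℂ] Y} (hP : P ∘L adjoint P = 1) (E : X ≃L[ℂ] X)
  (hE : ∀ f, P f = 0 → P (E f) = 0) (hE_symm : ∀ f, P f = 0 → P (E.symm f) = 0)

include hP hE in
theorem compression_mul_compression_symm :
    compression P (E : X →L[ℂ] X) * compression P (E.symm : X →L[ℂ] X) = 1 := by
  rw [← compression_mul_of_ker hP hE, ContinuousLinearMap.mul_def,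
    E.coe_comp_coe_symm]
  exact compression_one hP

include hP hE_symm in
theorem compression_symm_mul_adjoint :
    compression P ((E.symm : X →L[ℂ] X) ∘L adjoint (E.symm : X →L[ℂ] X)) =
      compression P (E.symm : X →L[ℂ] X) * adjoint (compression P (E.symm : X →L[ℂ] X)) := by
  rw [adjoint_compression]
  exact compression_mul_of_ker hP hE_symm _

include hP hE hE_symm in
theorem isUnit_compression_symm : IsUnit (compression P (E.symm : X →L[ℂ] X)) :=
  ⟨⟨_, _, compression_mul_compression_symm hP E.symm hE_symm,
    compression_mul_compression_symm hP E hE⟩, rfl⟩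

include hP hE hE_symm in
theorem isUnit_compression :
    IsUnit (compression P ((E.symm : X →L[ℂ] X) ∘L adjoint (E.symm : X →L[ℂ] X))) := by
  rw [compression_symm_mul_adjoint hP E hE_symm]
  exact (isUnit_compression_symm hP E hE hE_symm).mul
    (isUnit_compression_symm hP E hE hE_symm).star

include hP hE hE_symm in
theorem inverse_compression_apply (d : X) :
    Ring.inverse (compression P ((E.symm : X →L[ℂ] X) ∘L adjoint (E.symm : X →L[ℂ] X)))
      (P (E.symm d)) = adjoint (compression P (E : X →L[ℂ] X)) (P d) := by
  set F := compression P (E : X →L[ℂ] X)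
  set F' := compression P (E.symm : X →L[ℂ] X)
  have hadjoint : adjoint F' * adjoint F = 1 := by
    have h := congrArg star (compression_mul_compression_symm hP E hE)
    rwa [star_mul, star_one] at h
  set S := compression P ((E.symm : X →L[ℂ] X) ∘L adjoint (E.symm : X →L[ℂ] X)) with hS
  have hSF : S * adjoint F = F' := by
    rw [hS, compression_symm_mul_adjoint hP E hE_symm, mul_assoc, hadjoint, mul_one]
  have hinv : Ring.inverse S * F' = adjoint F := by
    rw [← hSF, Ring.inverse_mul_cancel_left _ _ (isUnit_compression hP E hE hE_symm)]
  rw [← hinv]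
  exact congrArg (Ring.inverse S : Y →L[ℂ] Y)
    (compression_apply_of_ker hP (T := (E.symm : X →L[ℂ] X)) hE_symm d).symm

end Equiv

end Compression

section Restriction

variable {n : ℕ} {l x : ℝ}

theorem restrict_restrict_Ioo (hx : x ∈ Icc 0 l) :
    (volume.restrict (Ioo 0 l)).restrict (Ioo 0 x) = (volume.restrict (Ioo 0 x) : Measure ℝ) := by
  rw [Measure.restrict_restrict measurableSet_Ioo,
    inter_eq_self_of_subset_left (Ioo_subset_Ioo_right hx.2)]

theorem coeFn_opP (f : L2 n l) :
    opP n l x f =ᵐ[(volume.restrict (Ioo 0 l)).restrict (Ioo 0 x)] f :=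
  LpToLpRestrictCLM_coeFn ℂ (Ioo 0 x) f

theorem opP_eq_zero_iff (hx : x ∈ Icc 0 l) (f : L2 n l) :
    opP n l x f = 0 ↔ ∀ᵐ t ∂volume.restrict (Ioo 0 x), f t = 0 := by
  rw [Lp.eq_zero_iff_ae_eq_zero, ← restrict_restrict_Ioo hx]
  exact (coeFn_opP f).congr_left

theorem adjoint_opP_ae_eq (g : L2Sub n l x) :
    ContinuousLinearMap.adjoint (opP n l x) g
      =ᵐ[volume.restrict (Ioo 0 l)] (Ioo 0 x).indicator g := by
  have hmem : MemLp ((Ioo 0 x).indicator g) 2 (volume.restrict (Ioo 0 l)) :=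
    (memLp_indicator_iff_restrict measurableSet_Ioo).2 (Lp.memLp g)
  have hadjoint : ContinuousLinearMap.adjoint (opP n l x) g = hmem.toLp _ := by
    refine ext_inner_right ℂ fun f => ?_
    have hopP : ∀ᵐ t ∂(volume.restrict (Ioo 0 l)).restrict (Ioo 0 x),
        inner ℂ (g t) (opP n l x f t) = inner ℂ (g t) (f t) := by
      filter_upwards [coeFn_opP (x := x) f] with t ht
      rw [ht]
    rw [ContinuousLinearMap.adjoint_inner_left, L2.inner_def, L2.inner_def,
      integral_congr_ae hopP, ← integral_indicator measurableSet_Ioo]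
    refine integral_congr_ae ?_
    filter_upwards [hmem.coeFn_toLp] with t ht
    rw [ht]
    by_cases htx : t ∈ Ioo 0 x
    · simp [indicator_of_mem htx]
    · simp [indicator_of_notMem htx]
  rw [hadjoint]
  exact hmem.coeFn_toLp

theorem opP_comp_adjoint : opP n l x ∘L ContinuousLinearMap.adjoint (opP n l x) = 1 := by
  ext1 g
  refine Lp.ext ((coeFn_opP _).trans ?_)
  filter_upwards [ae_restrict_of_ae (adjoint_opP_ae_eq g), ae_restrict_mem measurableSet_Ioo]
    with t ht htx
  exact ht.trans (indicator_of_mem htx g)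

end Restriction

/-! ### Triangular similarity operators -/

section Triangular

variable {n : ℕ} {l C : ℝ} {E : L2 n l ≃L[ℂ] L2 n l}

/-- `E` differs from multiplication by the invertible matrix `R` by an operator with a Volterra
bound, as does `(E f)(x) = R f(x) + ∫₀ˣ E(x, t) f(t) dt` with a kernel bounded by `C`. This is all
that is needed for `E` and `E⁻¹` to be triangular. -/
structure HasTriangularForm (E : L2 n l ≃L[ℂ] L2 n l) (R : Matrix (Fin n) (Fin n) ℂ)
    (C : ℝ) : Prop where
  det_ne_zero : R.det ≠ 0
  nonneg : 0 ≤ C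
  norm_sub_le : ∀ f, ∀ᵐ x ∂volume.restrict (Ioo 0 l),
    ‖E f x - matCLM R (f x)‖ ≤ C * ∫ t in (0 : ℝ)..x, ‖f t‖

theorem IsSimilarity.exists_hasTriangularForm {ι : Type} [Fintype ι] [DecidableEq ι]
    {F : ℝ → Matrix (Fin n) ι ℂ} {G : ℝ → Matrix ι (Fin n) ℂ} (hE : IsSimilarity F G E)
    (hl : 0 ≤ l) (hFG : ∀ᵐ x ∂volume.restrict (Ioo 0 l), deriv F x * G x = 0) :
    ∃ R C, HasTriangularForm E R C := by
  obtain ⟨ρ, k, hρ, hρ_deriv, hρ_det, -, ⟨C, hC⟩, hEf⟩ := hE.triangular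
  have hρ_deriv_zero : ∀ᵐ x, x ∈ uIcc 0 l → HasDerivAt ρ 0 x := by
    rw [← ae_restrict_iff' measurableSet_uIcc, uIcc_of_le hl, ← restrict_Ioo_eq_restrict_Icc]
    filter_upwards [hρ_deriv, hFG] with x hx hFGx
    simpa only [hFGx, Matrix.zero_mul, smul_zero] using hx
  obtain ⟨R, hR⟩ := hρ.const_of_ae_hasDerivAt_zero hρ_deriv_zero
  refine ⟨R, C, by rwa [← hR 0 left_mem_uIcc], (norm_nonneg _).trans (hC 0 0), fun f => ?_⟩
  filter_upwards [hEf f, ae_restrict_mem measurableSet_Ioo] with x hx hxl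
  rw [hx, hR x (by rw [uIcc_of_le hl]; exact Ioo_subset_Icc_self hxl), toEuclideanCLM_eq_matCLM,
    add_sub_cancel_left]
  exact norm_volterra_le (k := fun x t => Matrix.toEuclideanCLM (𝕜 := ℂ) (k x t)) hC hxl.1.le
    (intervalIntegrable_Lp_two f (Ioo_subset_Icc_self hxl)) x

namespace HasTriangularForm

variable {R : Matrix (Fin n) (Fin n) ℂ} (hE : HasTriangularForm E R C)
include hE

theorem norm_le (f : L2 n l) : ∀ᵐ x ∂volume.restrict (Ioo 0 l),
    ‖f x‖ ≤ ‖R⁻¹‖ * (‖E f x‖ + C * ∫ t in (0 : ℝ)..x, ‖f t‖) := by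
  filter_upwards [hE.norm_sub_le f] with x hx
  have inverse_apply : matCLM R⁻¹ (matCLM R (f x)) = f x := by
    rw [← ContinuousLinearMap.comp_apply, ← matCLM_mul,
      Matrix.nonsing_inv_mul R (isUnit_iff_ne_zero.2 hE.det_ne_zero), matCLM_one,
      ContinuousLinearMap.id_apply]
  calc ‖f x‖ = ‖matCLM R⁻¹ (E f x - (E f x - matCLM R (f x)))‖ := by
        rw [sub_sub_cancel, inverse_apply]
    _ ≤ ‖R⁻¹‖ * ‖E f x - (E f x - matCLM R (f x))‖ :=
        (matCLM R⁻¹).le_of_opNorm_le (matCLM.norm_map R⁻¹).le _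
    _ ≤ ‖R⁻¹‖ * (‖E f x‖ + C * ∫ t in (0 : ℝ)..x, ‖f t‖) := by
        gcongr
        exact norm_sub_le_of_le le_rfl hx

theorem opP_apply_eq_zero {x : ℝ} (hx : x ∈ Icc 0 l) (f : L2 n l) (hf : opP n l x f = 0) :
    opP n l x (E f) = 0 := by
  rw [opP_eq_zero_iff hx] at hf ⊢
  filter_upwards [ae_restrict_of_ae_restrict_of_subset (Ioo_subset_Ioo_right hx.2)
    (hE.norm_sub_le f), hf, ae_restrict_mem measurableSet_Ioo] with t ht hft htx
  have integral_eq_zero : ∫ s in (0 : ℝ)..t, ‖f s‖ = 0 := by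
    rw [intervalIntegral_congr_ae_Ioo (g := fun _ => 0) (hf.mono fun s hs => norm_eq_zero.2 hs)
      (Ioo_subset_Icc_self htx), intervalIntegral.integral_zero]
  rwa [hft, map_zero, sub_zero, integral_eq_zero, mul_zero, norm_le_zero_iff] at ht

theorem opP_symm_apply_eq_zero {x : ℝ} (hx : x ∈ Icc 0 l) (f : L2 n l) (hf : opP n l x f = 0) :
    opP n l x (E.symm f) = 0 := by
  rw [opP_eq_zero_iff hx] at hf ⊢
  refine ae_eq_zero_of_le_intervalIntegral (mul_nonneg (norm_nonneg R⁻¹) hE.nonneg)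
    (intervalIntegrable_Lp_two (E.symm f) hx) ?_
  filter_upwards [ae_restrict_of_ae_restrict_of_subset (Ioo_subset_Ioo_right hx.2)
    (hE.norm_le (E.symm f)), hf] with t ht hft
  rwa [E.apply_symm_apply, hft, norm_zero, zero_add, ← mul_assoc] at ht

theorem exists_norm_symm_apply_le {f : L2 n l} {B : ℝ}
    (hf : ∀ᵐ x ∂volume.restrict (Ioo 0 l), ‖f x‖ ≤ B) :
    ∃ D, ∀ᵐ x ∂volume.restrict (Ioo 0 l), ‖E.symm f x‖ ≤ D := by
  refine ⟨‖R⁻¹‖ * (B + C * ∫ t in (0 : ℝ)..l, ‖E.symm f t‖), ?_⟩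
  filter_upwards [hE.norm_le (E.symm f), hf, ae_restrict_mem measurableSet_Ioo] with x hx hfx hxl
  rw [E.apply_symm_apply] at hx
  refine hx.trans (mul_le_mul_of_nonneg_left (add_le_add hfx ?_) (norm_nonneg _))
  exact mul_le_mul_of_nonneg_left
    (integral_norm_Lp_two_mono (E.symm f) (Ioo_subset_Icc_self hxl)) hE.nonneg

end HasTriangularForm

end Triangular

section Gamma

variable {m₁ m₂ : ℕ} {l M : ℝ} {v : ℝ → Matrix (Fin m₁) (Fin m₂) ℂ}
  {u : ℝ → ℂ → Matrix (Fin m₁ ⊕ Fin m₂) (Fin m₁ ⊕ Fin m₂) ℂ} {E : L2 m₂ l ≃L[ℂ] L2 m₂ l}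

theorem IsNormalizedSimilarity.exists_hasTriangularForm (hE : IsNormalizedSimilarity (gamma u) E)
    (hl : 0 ≤ l) (hu : IsFundamentalSolution l v u) : ∃ R C, HasTriangularForm E R C := by
  refine hE.isSimilarity.exists_hasTriangularForm hl ?_
  filter_upwards [hu.deriv_gamma_mul_conjTranspose_gamma hl] with x hx
  rw [Matrix.mul_smul, hx, smul_zero]

theorem IsBoundedPotential.coeFn_column_conjTranspose (hv : IsBoundedPotential l M v)
    (i : Fin m₁) : column (volume.restrict (Ioo 0 l)) (fun t => (v t)ᴴ) i
      =ᵐ[volume.restrict (Ioo 0 l)] fun t => WithLp.toLp 2 fun a => (v t)ᴴ a i :=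
  coeFn_column_of_bound
    (continuous_id.matrix_conjTranspose.comp_stronglyMeasurable
      hv.stronglyMeasurable).aestronglyMeasurable
    (.of_forall fun x => (Matrix.l2_opNorm_conjTranspose (v x)).trans_le (hv.norm_le x)) i

theorem IsIntegration.symm_apply_ae_eq {n : ℕ} {A : L2 n l →L[ℂ] L2 n l} (hA : IsIntegration A)
    {E : L2 n l ≃L[ℂ] L2 n l} {d g : L2 n l} (h : E (A (E.symm d)) = Complex.I • g) :
    ∀ᵐ x ∂volume.restrict (Ioo 0 l), E.symm g x = -∫ t in (0 : ℝ)..x, E.symm d t := by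
  have symm_eq : E.symm g = (-Complex.I) • A (E.symm d) := by
    rw [← E.symm_apply_apply (A (E.symm d)), h, map_smul, smul_smul]
    simp
  filter_upwards [hA (E.symm d), Lp.coeFn_smul (-Complex.I) (A (E.symm d))] with x hx hsmul
  rw [symm_eq, hsmul, Pi.smul_apply, hx, smul_smul]
  simp

namespace IsFundamentalSolution

variable (hl : 0 ≤ l) (hu : IsFundamentalSolution l v u)
include hu

theorem matCLM_beta_zero_single_inl (i : Fin m₁) :
    matCLM (beta u 0) (EuclideanSpace.single (Sum.inl i) 1) = EuclideanSpace.single i 1 := by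
  rw [matCLM_single, hu.beta_zero]
  ext a
  simp [Matrix.one_apply]

theorem matCLM_gamma_zero_single_inl (i : Fin m₁) :
    matCLM (gamma u 0) (EuclideanSpace.single (Sum.inl i) 1) = 0 := by
  rw [matCLM_single, hu.gamma_zero]
  ext
  simp

include hl

theorem coeFn_column_gamma {q : ℕ} (e : Fin q → Fin m₁ ⊕ Fin m₂) (i : Fin q) :
    column (volume.restrict (Ioo 0 l)) (fun t => (gamma u t).submatrix id e) i
      =ᵐ[volume.restrict (Ioo 0 l)] fun t => WithLp.toLp 2 fun a => gamma u t a (e i) := by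
  have hcont : ContinuousOn (fun t => (gamma u t).submatrix id e) (Icc 0 l) := by
    have hgamma := hu.absolutelyContinuousOnInterval_gamma.continuousOn
    rw [uIcc_of_le hl] at hgamma
    exact (continuous_id.matrix_submatrix id e).comp_continuousOn hgamma
  obtain ⟨C, hC⟩ := isCompact_Icc.exists_bound_of_continuousOn hcont
  refine coeFn_column_of_bound ((hcont.mono Ioo_subset_Icc_self).aestronglyMeasurable
    measurableSet_Ioo) (C := C) ?_ i
  filter_upwards [ae_restrict_mem measurableSet_Ioo] with x hx
  exact hC x (Ioo_subset_Icc_self hx)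

theorem gamma_col_eq_neg_integral (hv : IsBoundedPotential l M v) (i : Fin m₁) {x : ℝ}
    (hx : x ∈ Icc 0 l) : (WithLp.toLp 2 fun a => gamma u x a (Sum.inl i) :
      EuclideanSpace ℂ (Fin m₂)) =
    -∫ t in (0 : ℝ)..x, matCLM (gamma u x * (gamma u t)ᴴ) (WithLp.toLp 2 fun a => (v t)ᴴ a i) := by
  have hD := hu.isDiracPair hl hv
  have hv' := hv.matCLM_comp
  have hw' := hv.matCLM_conjTranspose_comp
  have h := hD.apply_eq_neg hv'.isLocallyBounded hw'.isLocallyBounded hv'.norm_le hw'.norm_le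
    (κ := EuclideanSpace.single (Sum.inl i) 1)
    (by simpa using hu.matCLM_gamma_zero_single_inl i) x
  have hint := ((IsLocallyBounded.of_continuous hD.continuous_inverse).clm_apply
    (hw'.isLocallyBounded.clm_apply
      (.of_continuous (continuous_const (y := EuclideanSpace.single i 1))))).intervalIntegrable 0 x
  simp only [projIcc_of_mem hl hx, projIcc_left, hu.matCLM_beta_zero_single_inl] at h
  rw [matCLM_single, ← ContinuousLinearMap.intervalIntegral_comp_comm _ hint] at h
  rw [h]
  refine congrArg Neg.neg (intervalIntegral.integral_congr fun t ht => ?_)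
  rw [uIcc_of_le hx.1] at ht
  simp only [projIcc_of_mem hl (⟨ht.1, ht.2.trans hx.2⟩ : t ∈ Icc 0 l), matCLM_single, matCLM_mul,
    ContinuousLinearMap.comp_apply]

end IsFundamentalSolution

theorem IsVolterra.apply_column_conjTranspose {K : L2 m₂ l →L[ℂ] L2 m₂ l}
    (hK : IsVolterra (gamma u) (fun t => (-Complex.I) • (gamma u t)ᴴ) K) (hl : 0 ≤ l)
    (hu : IsFundamentalSolution l v u) (hv : IsBoundedPotential l M v) (i : Fin m₁) :
    K (column (volume.restrict (Ioo 0 l)) (fun t => (v t)ᴴ) i) =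
      Complex.I • column (volume.restrict (Ioo 0 l)) (fun t => (gamma u t).toCols₁) i := by
  refine Lp.ext ?_
  filter_upwards [hK (column (volume.restrict (Ioo 0 l)) (fun t => (v t)ᴴ) i),
    hu.coeFn_column_gamma hl Sum.inl i, Lp.coeFn_smul Complex.I
      (column (volume.restrict (Ioo 0 l)) (fun t => (gamma u t).toCols₁) i),
    ae_restrict_mem measurableSet_Ioo] with x hx hcol hsmul hxl
  have hxl := Ioo_subset_Icc_self hxl
  rw [hx, hsmul, Pi.smul_apply]
  refine Eq.trans ?_ (congrArg (Complex.I • ·)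
    ((hu.gamma_col_eq_neg_integral hl hv i hxl).symm.trans hcol.symm))
  simp only [smul_neg, ← neg_smul]
  rw [← intervalIntegral.integral_smul]
  refine intervalIntegral_congr_ae_Ioo ?_ hxl
  filter_upwards [hv.coeFn_column_conjTranspose i] with t ht
  rw [ht, toEuclideanCLM_eq_matCLM, Matrix.mul_smul, map_smul]
  rfl

theorem IsNormalizedSimilarity.symm_column_gamma (hE : IsNormalizedSimilarity (gamma u) E)
    (hl : 0 ≤ l) (hu : IsFundamentalSolution l v u) (hv : IsBoundedPotential l M v)
    (i : Fin m₁) : ∀ᵐ x ∂volume.restrict (Ioo 0 l),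
      E.symm (column (volume.restrict (Ioo 0 l)) (fun t => (gamma u t).toCols₁) i) x =
        -∫ t in (0 : ℝ)..x, E.symm (column (volume.restrict (Ioo 0 l)) (fun t => (v t)ᴴ) i) t := by
  obtain ⟨A, K, hA, hK, hKE⟩ := hE.isSimilarity.similar
  have h := hK.apply_column_conjTranspose hl hu hv i
  rw [hKE] at h
  exact hA.symm_apply_ae_eq h

end Gamma

/-! ### The matrix function `Φ₁` -/

section InnerColumns

variable {p : ℕ} {m n : Type*} {μ : Measure ℝ} {f g : Lp (EuclideanSpace ℂ (Fin p)) 2 μ}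
  {A : ℝ → Matrix m (Fin p) ℂ} {B : ℝ → Matrix (Fin p) n ℂ} {i : m} {j : n}
  (hf : f =ᵐ[μ] fun t => WithLp.toLp 2 fun a => (A t)ᴴ a i)
  (hg : g =ᵐ[μ] fun t => WithLp.toLp 2 fun a => B t a j)

include hf hg

theorem mul_apply_ae_eq_inner : (fun t => (A t * B t) i j) =ᵐ[μ] fun t => inner ℂ (f t) (g t) := by
  filter_upwards [hf, hg] with t hft hgt
  rw [hft, hgt, PiLp.inner_apply, Matrix.mul_apply]
  refine Finset.sum_congr rfl fun a _ => ?_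
  simp [mul_comm]

theorem integrable_mul_apply : Integrable (fun t => (A t * B t) i j) μ :=
  (L2.integrable_inner f g).congr (mul_apply_ae_eq_inner hf hg).symm

theorem integral_mul_apply : ∫ t, (A t * B t) i j ∂μ = inner ℂ f g := by
  rw [L2.inner_def, integral_congr_ae (mul_apply_ae_eq_inner hf hg)]

end InnerColumns

section PhiOne

variable {m₁ m₂ : ℕ} {l M : ℝ} {v : ℝ → Matrix (Fin m₁) (Fin m₂) ℂ}
  {u : ℝ → ℂ → Matrix (Fin m₁ ⊕ Fin m₂) (Fin m₁ ⊕ Fin m₂) ℂ} {E : L2 m₂ l ≃L[ℂ] L2 m₂ l}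
  (hl : 0 ≤ l) (hu : IsFundamentalSolution l v u) (hv : IsBoundedPotential l M v)
  (hE : IsNormalizedSimilarity (gamma u) E)

namespace IsNormalizedSimilarity

include hl hu hv hE

theorem exists_ae_norm_applyColumns_symm_le :
    ∃ C, ∀ᵐ x ∂volume.restrict (Ioo 0 l),
      ‖applyColumns (E.symm : L2 m₂ l →L[ℂ] L2 m₂ l) (fun t => (v t)ᴴ) x‖ ≤ C := by
  obtain ⟨R, C, hRC⟩ := hE.exists_hasTriangularForm hl hu
  refine exists_ae_norm_applyColumns_le fun k => hRC.exists_norm_symm_apply_le (B := M) ?_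
  filter_upwards [hv.coeFn_column_conjTranspose k] with x hx
  rw [hx]
  exact (norm_toLp_col_le _ _).trans
    ((Matrix.l2_opNorm_conjTranspose (v x)).trans_le (hv.norm_le x))

theorem exists_isBoundedPotential_neg_symm : ∃ C φ, IsBoundedPotential l C φ ∧
    (fun x => -applyColumns (E.symm : L2 m₂ l →L[ℂ] L2 m₂ l) (fun t => (v t)ᴴ) x)
      =ᵐ[volume.restrict (Ioo 0 l)] φ := by
  obtain ⟨C, hC⟩ := hE.exists_ae_norm_applyColumns_symm_le hl hu hv
  refine ⟨|C|, exists_isBoundedPotential (abs_nonneg C)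
    stronglyMeasurable_applyColumns.neg.aestronglyMeasurable ?_⟩
  filter_upwards [hC] with x hx
  exact (norm_neg _).trans_le (hx.trans (le_abs_self C))

variable {C : ℝ} {φ : ℝ → Matrix (Fin m₂) (Fin m₁) ℂ} (hφ : IsBoundedPotential l C φ)
  (hφ_eq : (fun x => -applyColumns (E.symm : L2 m₂ l →L[ℂ] L2 m₂ l) (fun t => (v t)ᴴ) x)
    =ᵐ[volume.restrict (Ioo 0 l)] φ)

include hφ hφ_eq

theorem integral_ae_eq_applyColumns_symm_gamma :
    ∀ᵐ x ∂volume.restrict (Ioo 0 l), ∫ t in (0 : ℝ)..x, φ t =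
      applyColumns (E.symm : L2 m₂ l →L[ℂ] L2 m₂ l) (fun t => (gamma u t).toCols₁) x := by
  filter_upwards [ae_all_iff.2 (hE.symm_column_gamma hl hu hv), ae_restrict_mem measurableSet_Ioo]
    with x hx hxl
  replace hxl := Ioo_subset_Icc_self hxl
  ext a i
  let proj : EuclideanSpace ℂ (Fin m₂) →L[ℂ] ℂ := EuclideanSpace.proj a
  let symmCol : L2 m₂ l := E.symm (column (volume.restrict (Ioo 0 l)) (fun t => (v t)ᴴ) i)
  have hφ_entry : (fun t => φ t a i) =ᵐ[volume.restrict (Ioo 0 l)] fun t => -proj (symmCol t) := by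
    filter_upwards [hφ_eq] with t ht
    rw [← ht]
    rfl
  calc (∫ t in (0 : ℝ)..x, φ t) a i = ∫ t in (0 : ℝ)..x, φ t a i := by
        simp only [intervalIntegral.integral_of_le hxl.1]
        exact integral_entry (hφ.isLocallyBounded.intervalIntegrable 0 x).1 a i
    _ = -∫ t in (0 : ℝ)..x, proj (symmCol t) := by
        rw [intervalIntegral_congr_ae_Ioo hφ_entry hxl, intervalIntegral.integral_neg]
    _ = proj (-∫ t in (0 : ℝ)..x, symmCol t) := by
        rw [proj.intervalIntegral_comp_comm (intervalIntegrable_Lp_two symmCol hxl), map_neg]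
    _ = _ := congrArg proj (hx i).symm

theorem isPhiOne_integral : IsPhiOne (gamma u) E fun x => ∫ t in (0 : ℝ)..x, φ t where
  eq_ae := hE.integral_ae_eq_applyColumns_symm_gamma hl hu hv hφ hφ_eq
  boundedlyDifferentiable := by
    have hprim := hφ.isLocallyBounded.isPrimitive
    obtain ⟨C', hC'⟩ := hprim.exists_lipschitzOnWith l
    refine ⟨hprim.absolutelyContinuousOnInterval 0 l, C', fun x hx => ?_⟩
    refine norm_deriv_le_of_lipschitzOn (Metric.closedBall_mem_nhds_of_mem ?_) hC'
    rw [Metric.mem_ball, Real.dist_0_eq_abs, abs_of_pos hx.1]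
    exact hx.2

end IsNormalizedSimilarity

theorem IsNormalizedSimilarity.exists_isPhiOne (hl : 0 ≤ l) (hu : IsFundamentalSolution l v u)
    (hv : IsBoundedPotential l M v) (hE : IsNormalizedSimilarity (gamma u) E) :
    ∃ Φ₁, IsPhiOne (gamma u) E Φ₁ := by
  obtain ⟨_, φ, hφ, hφ_eq⟩ := hE.exists_isBoundedPotential_neg_symm hl hu hv
  exact ⟨_, hE.isPhiOne_integral hl hu hv hφ hφ_eq⟩

namespace IsPhiOne

theorem eqOn {γ : ℝ → Matrix (Fin m₂) (Fin m₁ ⊕ Fin m₂) ℂ} {Φ₁ Ψ₁ : ℝ → Matrix (Fin m₂) (Fin m₁) ℂ}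
    (hl : 0 ≤ l) (hΦ : IsPhiOne γ E Φ₁) (hΨ : IsPhiOne γ E Ψ₁) : EqOn Φ₁ Ψ₁ (Ioo 0 l) := by
  have hcont {Θ} (hΘ : IsPhiOne γ E Θ) : ContinuousOn Θ (Ioo 0 l) :=
    hΘ.boundedlyDifferentiable.1.continuousOn.mono
      (by rw [uIcc_of_le hl]; exact Ioo_subset_Icc_self)
  have hae : Φ₁ =ᵐ[volume.restrict (Ioo 0 l)] Ψ₁ := by
    filter_upwards [hΦ.eq_ae, hΨ.eq_ae] with x hΦx hΨx
    rw [hΦx, hΨx]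
  exact Measure.eqOn_open_of_ae_eq hae isOpen_Ioo (hcont hΦ) (hcont hΨ)

variable {Φ₁ : ℝ → Matrix (Fin m₂) (Fin m₁) ℂ} (hΦ : IsPhiOne (gamma u) E Φ₁)

include hl hu hE hΦ

include hv in
theorem deriv_ae_eq : ∀ᵐ x ∂volume.restrict (Ioo 0 l),
    deriv Φ₁ x = -applyColumns (E.symm : L2 m₂ l →L[ℂ] L2 m₂ l) (fun t => (v t)ᴴ) x := by
  obtain ⟨_, φ, hφ, hφ_eq⟩ := hE.exists_isBoundedPotential_neg_symm hl hu hv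
  have heq := hΦ.eqOn hl (hE.isPhiOne_integral hl hu hv hφ hφ_eq)
  filter_upwards [ae_restrict_of_ae hφ.isLocallyBounded.isPrimitive.ae_hasDerivAt, hφ_eq,
    ae_restrict_mem measurableSet_Ioo] with x hx hφx hxl
  rw [(heq.eventuallyEq_of_mem (isOpen_Ioo.mem_nhds hxl)).deriv_eq, hx.deriv, hφx]

include hv in
theorem column_deriv (x : ℝ) (i : Fin m₁) :
    column ((volume.restrict (Ioo 0 l)).restrict (Ioo 0 x)) (deriv Φ₁) i =
      -opP m₂ l x (E.symm (column (volume.restrict (Ioo 0 l)) (fun t => (v t)ᴴ) i)) := by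
  refine column_eq_of_ae_eq ?_
  filter_upwards [ae_restrict_of_ae (hΦ.deriv_ae_eq hl hu hv hE),
    coeFn_opP (x := x) (E.symm (column (volume.restrict (Ioo 0 l)) (fun t => (v t)ᴴ) i)),
    Lp.coeFn_neg (opP m₂ l x (E.symm (column (volume.restrict (Ioo 0 l)) (fun t => (v t)ᴴ) i)))]
    with t hderiv hopP hneg
  rw [hneg, Pi.neg_apply, hopP, hderiv]
  rfl

theorem exists_apply_ae_eq_gamma_col (κ : Fin m₁ ⊕ Fin m₂) : ∃ f : L2 m₂ l,
    (E f =ᵐ[volume.restrict (Ioo 0 l)] fun t => WithLp.toLp 2 fun a => gamma u t a κ) ∧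
    f =ᵐ[volume.restrict (Ioo 0 l)] fun t => WithLp.toLp 2 fun a =>
      Matrix.fromCols (Φ₁ t) (1 : Matrix (Fin m₂) (Fin m₂) ℂ) a κ := by
  rcases κ with i | k
  · refine ⟨E.symm (column (volume.restrict (Ioo 0 l)) (fun t => (gamma u t).toCols₁) i), ?_, ?_⟩
    · rw [E.apply_symm_apply]
      exact hu.coeFn_column_gamma hl Sum.inl i
    · filter_upwards [hΦ.eq_ae] with t ht
      simp only [Matrix.fromCols_apply_inl, ht]
      rfl
  · refine ⟨E.symm (column (volume.restrict (Ioo 0 l)) (fun t => (gamma u t).toCols₂) k), ?_, ?_⟩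
    · rw [E.apply_symm_apply]
      exact hu.coeFn_column_gamma hl Sum.inr k
    · filter_upwards [hE.normalized] with t ht
      simp only [Matrix.fromCols_apply_inr, ← ht]
      rfl

end IsPhiOne

/-! ### Recovery of `β` -/

theorem IsNormalizedSimilarity.isUnit_opSx (hl : 0 ≤ l) (hu : IsFundamentalSolution l v u)
    (hE : IsNormalizedSimilarity (gamma u) E) {x : ℝ} (hx : x ∈ Icc 0 l) :
    IsUnit (opSx (opS E) x) := by
  obtain ⟨R, C, hRC⟩ := hE.exists_hasTriangularForm hl hu
  exact isUnit_compression opP_comp_adjoint E (hRC.opP_apply_eq_zero hx)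
    (hRC.opP_symm_apply_eq_zero hx)

namespace IsFundamentalSolution

include hu hv

theorem isLocallyBounded_mul_gamma :
    IsLocallyBounded fun t => v t * gamma u (projIcc 0 l hl t) := by
  let toMatrix : (EuclideanSpace ℂ (Fin m₁ ⊕ Fin m₂) →L[ℂ] EuclideanSpace ℂ (Fin m₁)) →L[ℂ]
      Matrix (Fin m₁) (Fin m₁ ⊕ Fin m₂) ℂ :=
    matCLM.symm.toContinuousLinearEquiv.toContinuousLinearMap
  have h := (IsLocallyBounded.of_continuous (continuous_const (y := toMatrix))).clm_apply
    (hu.isDiracPair hl hv).isPrimitive_left.isLocallyBounded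
  simp only [← matCLM_mul] at h
  convert! h using 2 with t
  exact (matCLM.symm_apply_apply _).symm

include hl

theorem intervalIntegrable_mul_gamma {x : ℝ} (hx : x ∈ Icc 0 l) :
    IntervalIntegrable (fun t => v t * gamma u t) volume 0 x := by
  refine ((hu.isLocallyBounded_mul_gamma hl hv).intervalIntegrable 0 x).congr fun t ht => ?_
  rw [uIoc_of_le hx.1] at ht
  simp only [projIcc_of_mem hl (⟨ht.1.le, ht.2.trans hx.2⟩ : t ∈ Icc 0 l)]

theorem beta_eq_add_integral {x : ℝ} (hx : x ∈ Icc 0 l) :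
    beta u x = Matrix.fromCols 1 0 + ∫ t in (0 : ℝ)..x, v t * gamma u t := by
  have hderiv : ∀ᵐ t, t ∈ uIcc 0 l →
      HasDerivAt (beta u) (v t * gamma u (projIcc 0 l hl t)) t := by
    rw [← ae_restrict_iff' measurableSet_uIcc, uIcc_of_le hl, ← restrict_Ioo_eq_restrict_Icc]
    filter_upwards [hu.hasDerivAt_beta, ae_restrict_mem measurableSet_Ioo] with t ht htl
    rwa [projIcc_of_mem hl (Ioo_subset_Icc_self htl)]
  rw [eq_add_integral_of_ae_hasDerivAt hu.absolutelyContinuousOnInterval_beta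
    (hu.isLocallyBounded_mul_gamma hl hv) hderiv x (by rwa [uIcc_of_le hl]), hu.beta_zero]
  refine congrArg (Matrix.fromCols 1 0 + ·) (intervalIntegral.integral_congr fun t ht => ?_)
  rw [uIcc_of_le hx.1] at ht
  simp only [projIcc_of_mem hl (⟨ht.1, ht.2.trans hx.2⟩ : t ∈ Icc 0 l)]

end IsFundamentalSolution

namespace IsPhiOne

variable {Φ₁ : ℝ → Matrix (Fin m₂) (Fin m₁) ℂ} (hΦ : IsPhiOne (gamma u) E Φ₁) {x : ℝ}
  (hx : x ∈ Icc 0 l)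

include hl hu hv hE hΦ hx

theorem inverse_opSx_column_deriv (i : Fin m₁) :
    Ring.inverse (opSx (opS E) x)
        (column ((volume.restrict (Ioo 0 l)).restrict (Ioo 0 x)) (deriv Φ₁) i) =
      -ContinuousLinearMap.adjoint (compression (opP m₂ l x) (E : L2 m₂ l →L[ℂ] L2 m₂ l))
        (opP m₂ l x (column (volume.restrict (Ioo 0 l)) (fun t => (v t)ᴴ) i)) := by
  obtain ⟨R, C, hRC⟩ := hE.exists_hasTriangularForm hl hu
  rw [hΦ.column_deriv hl hu hv hE, map_neg]
  exact congrArg Neg.neg (inverse_compression_apply opP_comp_adjoint E (hRC.opP_apply_eq_zero hx)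
    (hRC.opP_symm_apply_eq_zero hx) _)

theorem inner_inverse_opSx_column_deriv (i : Fin m₁) (f : L2 m₂ l) :
    inner ℂ (Ring.inverse (opSx (opS E) x)
        (column ((volume.restrict (Ioo 0 l)).restrict (Ioo 0 x)) (deriv Φ₁) i)) (opP m₂ l x f) =
      -inner ℂ (opP m₂ l x (column (volume.restrict (Ioo 0 l)) (fun t => (v t)ᴴ) i))
        (opP m₂ l x (E f)) := by
  obtain ⟨R, C, hRC⟩ := hE.exists_hasTriangularForm hl hu
  rw [hΦ.inverse_opSx_column_deriv hl hu hv hE hx, inner_neg_left,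
    ContinuousLinearMap.adjoint_inner_left, compression_apply_of_ker opP_comp_adjoint
      (T := (E : L2 m₂ l →L[ℂ] L2 m₂ l)) (hRC.opP_apply_eq_zero hx)]
  rfl

theorem integral_inverse_opSx_mul_apply (i : Fin m₁) (κ : Fin m₁ ⊕ Fin m₂) :
    Integrable (fun t => ((applyColumns (Ring.inverse (opSx (opS E) x)) (deriv Φ₁) t)ᴴ *
      Matrix.fromCols (Φ₁ t) (1 : Matrix (Fin m₂) (Fin m₂) ℂ)) i κ)
      ((volume.restrict (Ioo 0 l)).restrict (Ioo 0 x)) ∧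
    ∫ t, ((applyColumns (Ring.inverse (opSx (opS E) x)) (deriv Φ₁) t)ᴴ *
        Matrix.fromCols (Φ₁ t) (1 : Matrix (Fin m₂) (Fin m₂) ℂ)) i κ
        ∂((volume.restrict (Ioo 0 l)).restrict (Ioo 0 x)) =
      -∫ t, (v t * gamma u t) i κ ∂((volume.restrict (Ioo 0 l)).restrict (Ioo 0 x)) := by
  obtain ⟨f, hEf, hf⟩ := hΦ.exists_apply_ae_eq_gamma_col hl hu hE κ
  have hinverse : Ring.inverse (opSx (opS E) x)
      (column ((volume.restrict (Ioo 0 l)).restrict (Ioo 0 x)) (deriv Φ₁) i)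
        =ᵐ[(volume.restrict (Ioo 0 l)).restrict (Ioo 0 x)] fun t => WithLp.toLp 2 fun a =>
          (applyColumns (Ring.inverse (opSx (opS E) x)) (deriv Φ₁) t)ᴴᴴ a i := by
    simp only [Matrix.conjTranspose_conjTranspose]
    rfl
  have hcol := (coeFn_opP (x := x) (column _ _ i)).trans
    (ae_restrict_of_ae (hv.coeFn_column_conjTranspose i))
  have hPf := (coeFn_opP (x := x) f).trans (ae_restrict_of_ae hf)
  have hPEf := (coeFn_opP (x := x) (E f)).trans (ae_restrict_of_ae hEf)
  refine ⟨integrable_mul_apply hinverse hPf, ?_⟩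
  rw [integral_mul_apply hinverse hPf, integral_mul_apply hcol hPEf,
    hΦ.inner_inverse_opSx_column_deriv hl hu hv hE hx]

theorem intervalIntegrable_inverse_opSx_mul :
    IntervalIntegrable (fun t =>
      (applyColumns (Ring.inverse (opSx (opS E) x)) (deriv Φ₁) t)ᴴ *
        Matrix.fromCols (Φ₁ t) (1 : Matrix (Fin m₂) (Fin m₂) ℂ)) volume 0 x := by
  rw [intervalIntegrable_iff_integrableOn_Ioo_of_le hx.1, IntegrableOn, ← restrict_restrict_Ioo hx]
  exact integrable_of_entries fun i κ =>
    (hΦ.integral_inverse_opSx_mul_apply hl hu hv hE hx i κ).1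

theorem beta_eq_sub_integral :
    beta u x = Matrix.fromCols 1 0 -
      ∫ t in (0 : ℝ)..x,
        (applyColumns (Ring.inverse (opSx (opS E) x)) (deriv Φ₁) t)ᴴ *
          Matrix.fromCols (Φ₁ t) (1 : Matrix (Fin m₂) (Fin m₂) ℂ) := by
  have hint := hΦ.intervalIntegrable_inverse_opSx_mul hl hu hv hE hx
  have hint' := hu.intervalIntegrable_mul_gamma hl hv hx
  rw [intervalIntegrable_iff_integrableOn_Ioo_of_le hx.1, IntegrableOn,
    ← restrict_restrict_Ioo hx] at hint hint'
  rw [hu.beta_eq_add_integral hl hv hx, sub_eq_add_neg]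
  congr 1
  simp only [intervalIntegral.integral_of_le hx.1, ← restrict_Ioo_eq_restrict_Ioc,
    ← restrict_restrict_Ioo hx]
  ext i κ
  rw [Matrix.neg_apply, integral_entry hint, integral_entry hint',
    (hΦ.integral_inverse_opSx_mul_apply hl hu hv hE hx i κ).2, neg_neg]

end IsPhiOne

end PhiOne

end SkewDirac

theorem mainTheorem10 (m₁ m₂ : ℕ) (l M : ℝ) (hl : 0 < l)
    (v : ℝ → Matrix (Fin m₁) (Fin m₂) ℂ)
    (hv : AEStronglyMeasurable v (volume.restrict (Ioo 0 l)))
    (hM : ∀ x ∈ Ioo 0 l, ‖v x‖ ≤ M)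
    (u : ℝ → ℂ → Matrix (Fin m₁ ⊕ Fin m₂) (Fin m₁ ⊕ Fin m₂) ℂ)
    (hu : IsFundamentalSolution l v u) :
    (∃ E : L2 m₂ l ≃L[ℂ] L2 m₂ l, IsNormalizedSimilarity (gamma u) E) ∧
    ∀ E : L2 m₂ l ≃L[ℂ] L2 m₂ l, IsNormalizedSimilarity (gamma u) E →
      (∃ Φ₁ : ℝ → Matrix (Fin m₂) (Fin m₁) ℂ, IsPhiOne (gamma u) E Φ₁) ∧
      ∀ Φ₁ : ℝ → Matrix (Fin m₂) (Fin m₁) ℂ, IsPhiOne (gamma u) E Φ₁ →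
        ∀ x ∈ Icc 0 l,
          IsUnit (opSx (opS E) x) ∧
          IntervalIntegrable (fun t =>
            (applyColumns (Ring.inverse (opSx (opS E) x)) (deriv Φ₁) t)ᴴ *
              Matrix.fromCols (Φ₁ t) (1 : Matrix (Fin m₂) (Fin m₂) ℂ)) volume 0 x ∧
          beta u x = Matrix.fromCols 1 0 -
            ∫ t in (0 : ℝ)..x,
              (applyColumns (Ring.inverse (opSx (opS E) x)) (deriv Φ₁) t)ᴴ *
                Matrix.fromCols (Φ₁ t) (1 : Matrix (Fin m₂) (Fin m₂) ℂ) := by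
  have hM0 : 0 ≤ M := (norm_nonneg _).trans (hM (l / 2) ⟨by linarith, by linarith⟩)
  obtain ⟨w, hw, hvw⟩ :=
    exists_isBoundedPotential hM0 hv (ae_restrict_of_forall_mem measurableSet_Ioo hM)
  have hu' : IsFundamentalSolution l w u := hu.congr hvw
  exact ⟨hu'.exists_isNormalizedSimilarity hl.le hw, fun E hE =>
    ⟨hE.exists_isPhiOne hl.le hu' hw, fun Φ₁ hΦ x hx =>
      ⟨hE.isUnit_opSx hl.le hu' hx,
        hΦ.intervalIntegrable_inverse_opSx_mul hl.le hu' hw hE hx,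
        hΦ.beta_eq_sub_integral hl.le hu' hw hE hx⟩⟩⟩
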